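/- Consider a random access machine whose input is a read-only array of $n\ge 1$ points $p_1,\dots,p_n\in\mathbb{R}^2$ (in arbitrary order; repeated points, equal coordinates and collinearities are allowed), whose work-space consists of words of $O(\log n)$ bits, and which has a write-only output. In one step it performs an arithmetic operation on or a comparison of words, an access to the work-space or to the input, an arithmetic operation $+,-,\times$ on reals while evaluating a polynomial expression in coordinates of input points, a test of the sign of such an expression, or the report of an input point to the output; real numbers are not stored in the work-space (points are stored as indices). There are one fixed program for this machine and a constant $C$ such that for every $n\ge 1$ and every input array the program halts, reports the vertices (extreme points) of the convex hull of $\{p_1,\dots,p_n\}$, each exactly once and in clockwise order along the boundary, uses at most $C\,n^{1/2}$ words of work-space, and takes at most $C\,n^{3/2+\varepsilon}$ steps for every real $\varepsilon$ with $\sqrt{\log\log n/\log n}<\varepsilon<1$. (Here $\log$ is the natural logarithm; for $n\le 2$ the lower bound on $\varepsilon$ is read as $0$.) -/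

import Mathlib

/-!
A random access machine for planar point sets, with a read-only input array of `n` points, a
work-space of words, and a write-only output.

* Input: an array `P` of `n` points with real coordinates. No instruction modifies it.
* Work-space: `k` registers and `m` arrays of `s` cells each. Every register and every cell holds
  one word, a natural number below the word bound `w`. Accessing a cell outside the arrays or
  storing a number that is not a word is a fault: the run has no continuation.
* Real numbers occur only inside tests, which decide the sign of an arithmetic expression in the
  coordinates of input points. They cannot be stored, so that no information can be packed into a
  single real cell; a point is stored as its index in the input array.
* Output: a list of points, extended at its end by the instruction `report`, and never read.
* Time: every operation, comparison, memory access, input access and report costs one step.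
-/

namespace PointRAM

/-- Word expressions over `k` registers. -/
inductive WExp (k : ℕ) : Type
  | lit (c : ℕ) : WExp k
  /-- the number of input points -/
  | len : WExp k
  | reg (r : Fin k) : WExp k
  | add (a b : WExp k) : WExp k
  /-- truncated subtraction -/
  | sub (a b : WExp k) : WExp k
  | mul (a b : WExp k) : WExp k
  /-- division rounded down -/
  | div (a b : WExp k) : WExp k

namespace WExp

variable {k : ℕ}

def eval (n : ℕ) (ρ : Fin k → ℕ) : WExp k → ℕ
  | lit c => c
  | len => n
  | reg r => ρ r
  | add a b => a.eval n ρ + b.eval n ρ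
  | sub a b => a.eval n ρ - b.eval n ρ
  | mul a b => a.eval n ρ * b.eval n ρ
  | div a b => a.eval n ρ / b.eval n ρ

def cost : WExp k → ℕ
  | lit _ => 1
  | len => 1
  | reg _ => 1
  | add a b => a.cost + b.cost + 1
  | sub a b => a.cost + b.cost + 1
  | mul a b => a.cost + b.cost + 1
  | div a b => a.cost + b.cost + 1

end WExp

/-- Reading the input array; a position outside the array reads as the origin. -/
noncomputable def readPoint {n : ℕ} (P : Fin n → ℝ × ℝ) (i : ℕ) : ℝ × ℝ :=
  if h : i < n then P ⟨i, h⟩ else 0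

/-- Real expressions in the coordinates of input points. -/
inductive RExp (k : ℕ) : Type
  | const (c : ℤ) : RExp k
  /-- first coordinate of the input point at position `e` -/
  | xCoord (e : WExp k) : RExp k
  /-- second coordinate of the input point at position `e` -/
  | yCoord (e : WExp k) : RExp k
  | add (a b : RExp k) : RExp k
  | sub (a b : RExp k) : RExp k
  | mul (a b : RExp k) : RExp k

namespace RExp

variable {k n : ℕ}

noncomputable def eval (P : Fin n → ℝ × ℝ) (ρ : Fin k → ℕ) : RExp k → ℝ
  | const c => (c : ℝ)
  | xCoord e => (readPoint P (e.eval n ρ)).1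
  | yCoord e => (readPoint P (e.eval n ρ)).2
  | add a b => a.eval P ρ + b.eval P ρ
  | sub a b => a.eval P ρ - b.eval P ρ
  | mul a b => a.eval P ρ * b.eval P ρ

def cost : RExp k → ℕ
  | const _ => 1
  | xCoord e => e.cost + 1
  | yCoord e => e.cost + 1
  | add a b => a.cost + b.cost + 1
  | sub a b => a.cost + b.cost + 1
  | mul a b => a.cost + b.cost + 1

end RExp

/-- Tests. -/
inductive Test (k : ℕ) : Type
  | lt (a b : WExp k) : Test k
  | eq (a b : WExp k) : Test k
  /-- the real number `a` is positive -/
  | pos (a : RExp k) : Test k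
  | not (t : Test k) : Test k
  | and (t u : Test k) : Test k
  | or (t u : Test k) : Test k

namespace Test

variable {k n : ℕ}

def Holds (P : Fin n → ℝ × ℝ) (ρ : Fin k → ℕ) : Test k → Prop
  | lt a b => a.eval n ρ < b.eval n ρ
  | eq a b => a.eval n ρ = b.eval n ρ
  | pos a => 0 < a.eval P ρ
  | not t => ¬ t.Holds P ρ
  | and t u => t.Holds P ρ ∧ u.Holds P ρ
  | or t u => t.Holds P ρ ∨ u.Holds P ρ

def cost : Test k → ℕ
  | lt a b => a.cost + b.cost + 1
  | eq a b => a.cost + b.cost + 1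
  | pos a => a.cost + 1
  | not t => t.cost + 1
  | and t u => t.cost + u.cost + 1
  | or t u => t.cost + u.cost + 1

end Test

/-- Programs with `k` registers and `m` work arrays. -/
inductive Prog (k m : ℕ) : Type
  | skip : Prog k m
  /-- `r := e` -/
  | assign (r : Fin k) (e : WExp k) : Prog k m
  /-- `r := a[i]` -/
  | load (r : Fin k) (a : Fin m) (i : WExp k) : Prog k m
  /-- `a[i] := e` -/
  | store (a : Fin m) (i e : WExp k) : Prog k m
  /-- append the input point at position `e` to the output -/
  | report (e : WExp k) : Prog k m
  | seq (p q : Prog k m) : Prog k m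
  | ite (t : Test k) (p q : Prog k m) : Prog k m
  /-- repeat `p` as long as `t` holds -/
  | loop (t : Test k) (p : Prog k m) : Prog k m

/-- Contents of the registers and of the work arrays, and the output written so far. -/
structure State (k m : ℕ) : Type where
  reg : Fin k → ℕ
  arr : Fin m → ℕ → ℕ
  out : List (ℝ × ℝ)

/-- The initial state: a work-space filled with zeros and an empty output. -/
def State.init (k m : ℕ) : State k m where
  reg := fun _ => 0
  arr := fun _ _ => 0
  out := []

/-- `Exec P s w p σ t τ`: on the input array `P`, with work arrays of `s` cells and with words below
`w`, the program `p` started in `σ` halts without a fault after `t` steps in `τ`. -/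
inductive Exec {k m n : ℕ} (P : Fin n → ℝ × ℝ) (s w : ℕ) :
    Prog k m → State k m → ℕ → State k m → Prop
  | skip (σ : State k m) : Exec P s w Prog.skip σ 1 σ
  | assign (σ : State k m) (r : Fin k) (e : WExp k) (hw : e.eval n σ.reg < w) :
      Exec P s w (Prog.assign r e) σ (e.cost + 1)
        { σ with reg := Function.update σ.reg r (e.eval n σ.reg) }
  | load (σ : State k m) (r : Fin k) (a : Fin m) (i : WExp k) (hi : i.eval n σ.reg < s) :
      Exec P s w (Prog.load r a i) σ (i.cost + 1)
        { σ with reg := Function.update σ.reg r (σ.arr a (i.eval n σ.reg)) }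
  | store (σ : State k m) (a : Fin m) (i e : WExp k) (hi : i.eval n σ.reg < s)
      (hw : e.eval n σ.reg < w) :
      Exec P s w (Prog.store a i e) σ (i.cost + e.cost + 1)
        { σ with
          arr := Function.update σ.arr a
            (Function.update (σ.arr a) (i.eval n σ.reg) (e.eval n σ.reg)) }
  | report (σ : State k m) (e : WExp k) :
      Exec P s w (Prog.report e) σ (e.cost + 1)
        { σ with out := σ.out ++ [readPoint P (e.eval n σ.reg)] }
  | seq {σ₁ σ₂ σ₃ : State k m} {p q : Prog k m} {t₁ t₂ : ℕ}
      (h₁ : Exec P s w p σ₁ t₁ σ₂) (h₂ : Exec P s w q σ₂ t₂ σ₃) :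
      Exec P s w (Prog.seq p q) σ₁ (t₁ + t₂) σ₃
  | ite_true {σ₁ σ₂ : State k m} {c : Test k} {p q : Prog k m} {t : ℕ}
      (hc : c.Holds P σ₁.reg) (h : Exec P s w p σ₁ t σ₂) :
      Exec P s w (Prog.ite c p q) σ₁ (c.cost + t) σ₂
  | ite_false {σ₁ σ₂ : State k m} {c : Test k} {p q : Prog k m} {t : ℕ}
      (hc : ¬ c.Holds P σ₁.reg) (h : Exec P s w q σ₁ t σ₂) :
      Exec P s w (Prog.ite c p q) σ₁ (c.cost + t) σ₂
  | loop_true {σ₁ σ₂ σ₃ : State k m} {c : Test k} {p : Prog k m} {t₁ t₂ : ℕ}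
      (hc : c.Holds P σ₁.reg) (h₁ : Exec P s w p σ₁ t₁ σ₂)
      (h₂ : Exec P s w (Prog.loop c p) σ₂ t₂ σ₃) :
      Exec P s w (Prog.loop c p) σ₁ (c.cost + t₁ + t₂) σ₃
  | loop_false {σ : State k m} {c : Test k} {p : Prog k m}
      (hc : ¬ c.Holds P σ.reg) :
      Exec P s w (Prog.loop c p) σ c.cost σ

end PointRAM

/-- Twice the signed area of the triangle `p q r`; negative iff `p, q, r` is a right turn. -/
def orientation2D (p q r : ℝ × ℝ) : ℝ :=
  (q.1 - p.1) * (r.2 - p.2) - (q.2 - p.2) * (r.1 - p.1)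

/-- `L` lists the vertices of the convex hull of `S`, each exactly once, in clockwise order along
the boundary: any three of them, taken in the order of the list, make a right turn. -/
structure IsConvexHullList (S : Set (ℝ × ℝ)) (L : List (ℝ × ℝ)) : Prop where
  nodup : L.Nodup
  mem_iff : ∀ p, p ∈ L ↔ p ∈ (convexHull ℝ S).extremePoints ℝ
  clockwise : L.Triplewise fun p q r => orientation2D p q r < 0

/-! ### Lexicographic order and turns of planar points -/

namespace PlanarHull

/-! Let `S` be the least number with `n ≤ S * S`. The positions can be streamed in sorted order with
about `S` words: the array is cut into blocks of `S` positions, and for each block only its first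
position after the current one is kept. A step of the stream takes the first of these candidates and
rescans the one block it came from, which costs O(S) (`wp_next`).

The boundary consists of two chains, monotone in lexicographic order and in its reverse, and each
comes from a right-turn scan of the stream with a stack. A full stack would be too large, so the
stream is consumed in batches of `S` positions. After each batch one scan over all pending positions
pops every top that some pending position shows to be off the hull. A single scan suffices: a point
to the right of the popped edge is also to the right of the edge below it (`StackInv.topKept_pop`,
from `turn_trans`). What remains can no longer be refuted, so all of the stack but its top is
reported and the top becomes an unpoppable base (`StackInv.flush`). A batch costs O(S²) and there
are at most about n/S of them, so the total is O(S³) = O(n^(3/2)); the ε of the time bound is not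
needed.

Geometrically, a point missing from a chain lies weakly on the wrong side of a segment of input
points. A point missing from both chains is therefore no vertex (`not_mem_extremePoints`), while a
list that turns right throughout has no point in the hull of its others
(`not_mem_convexHull_of_triplewise`). Gluing the two chains at their common ends gives the clockwise
list (`isConvexHullList_of_chains`). -/

/-- The lexicographic order of the plane. -/
def lexLt (p q : ℝ × ℝ) : Prop := p.1 < q.1 ∨ (p.1 = q.1 ∧ p.2 < q.2)

/-- The lexicographic order if `d` is true, and its reverse otherwise. -/
def dirLt (d : Bool) (p q : ℝ × ℝ) : Prop := if d then lexLt p q else lexLt q p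

theorem lexLt_trans {p q r : ℝ × ℝ} (h : lexLt p q) (h' : lexLt q r) : lexLt p r := by
  unfold lexLt at *; grind

theorem lexLt_irrefl (p : ℝ × ℝ) : ¬ lexLt p p := by
  unfold lexLt; grind

theorem lexLt_total (p q : ℝ × ℝ) : lexLt p q ∨ p = q ∨ lexLt q p := by
  unfold lexLt; rw [Prod.ext_iff]; grind

theorem dirLt_trans {d : Bool} {p q r : ℝ × ℝ} (h : dirLt d p q) (h' : dirLt d q r) :
    dirLt d p r := by
  cases d
  · exact lexLt_trans h' h
  · exact lexLt_trans h h'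

theorem dirLt_irrefl (d : Bool) (p : ℝ × ℝ) : ¬ dirLt d p p := by
  cases d <;> exact lexLt_irrefl p

theorem dirLt_total (d : Bool) (p q : ℝ × ℝ) : dirLt d p q ∨ p = q ∨ dirLt d q p := by
  cases d
  · rcases lexLt_total q p with h | h | h
    exacts [Or.inl h, Or.inr (Or.inl h.symm), Or.inr (Or.inr h)]
  · exact lexLt_total p q

theorem dirLt_not (d : Bool) (p q : ℝ × ℝ) : dirLt (!d) p q ↔ dirLt d q p := by
  cases d <;> simp [dirLt]

/-- Among vectors of a half-plane, being clockwise from one another is transitive. -/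
theorem cross_neg_trans {x₁ y₁ x₂ y₂ x₃ y₃ : ℝ} (h₁ : 0 < x₁ ∨ (0 = x₁ ∧ 0 < y₁))
    (h₂ : 0 < x₂ ∨ (0 = x₂ ∧ 0 < y₂)) (h₃ : 0 < x₃ ∨ (0 = x₃ ∧ 0 < y₃))
    (h₁₂ : x₁ * y₂ - y₁ * x₂ < 0) (h₂₃ : x₂ * y₃ - y₂ * x₃ < 0) :
    x₁ * y₃ - y₁ * x₃ < 0 := by
  by_contra! h
  -- For plane vectors, (v₁ × v₃) v₂ = (v₂ × v₃) v₁ + (v₁ × v₂) v₃. The first coordinate already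
  -- gives contradictory signs unless `v₁` and `v₃` are both vertical, and then their cross product
  -- with `v₂` cannot have the assumed signs.
  have hx : (x₁ * y₃ - y₁ * x₃) * x₂ =
      (x₂ * y₃ - y₂ * x₃) * x₁ + (x₁ * y₂ - y₁ * x₂) * x₃ := by ring
  have hy : (x₁ * y₃ - y₁ * x₃) * y₂ =
      (x₂ * y₃ - y₂ * x₃) * y₁ + (x₁ * y₂ - y₁ * x₂) * y₃ := by ring
  have hx₂ : 0 ≤ x₂ := by grind
  have := mul_nonneg h hx₂
  rcases h₁ with h₁ | ⟨h₁, k₁⟩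
  · have := mul_neg_of_neg_of_pos h₂₃ h₁
    rcases h₃ with h₃ | ⟨h₃, k₃⟩
    · have := mul_neg_of_neg_of_pos h₁₂ h₃
      linarith
    · subst h₃; linarith
  · subst h₁
    rcases h₃ with h₃ | ⟨h₃, k₃⟩
    · have := mul_neg_of_neg_of_pos h₁₂ h₃
      linarith
    · subst h₃
      have := mul_neg_of_neg_of_pos h₁₂ k₃
      have := mul_neg_of_neg_of_pos h₂₃ k₁
      linarith

/-- Among vectors of a half-plane, not being clockwise from one another is transitive. -/
theorem cross_nonneg_trans {x₁ y₁ x₂ y₂ x₃ y₃ : ℝ} (h₁ : 0 < x₁ ∨ (0 = x₁ ∧ 0 < y₁))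
    (h₂ : 0 < x₂ ∨ (0 = x₂ ∧ 0 < y₂)) (h₃ : 0 < x₃ ∨ (0 = x₃ ∧ 0 < y₃))
    (h₁₂ : 0 ≤ x₁ * y₂ - y₁ * x₂) (h₂₃ : 0 ≤ x₂ * y₃ - y₂ * x₃) :
    0 ≤ x₁ * y₃ - y₁ * x₃ := by
  by_contra! h
  have hx : (x₁ * y₃ - y₁ * x₃) * x₂ =
      (x₂ * y₃ - y₂ * x₃) * x₁ + (x₁ * y₂ - y₁ * x₂) * x₃ := by ring
  have hx₁ : 0 ≤ x₁ := by grind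
  have hx₃ : 0 ≤ x₃ := by grind
  have := mul_nonneg h₂₃ hx₁
  have := mul_nonneg h₁₂ hx₃
  rcases h₂ with h₂ | ⟨h₂, k₂⟩
  · have := mul_neg_of_neg_of_pos h h₂
    linarith
  · subst h₂
    have e₁ : x₁ = 0 := by
      have : 0 ≤ x₁ * y₂ := by linarith
      have : x₃ * y₂ ≤ 0 := by linarith
      have : x₃ = 0 := by nlinarith
      subst this
      by_contra hne
      have h₁' : 0 < x₁ := lt_of_le_of_ne hx₁ (Ne.symm hne)
      rcases h₃ with h₃ | ⟨-, k₃⟩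
      · exact lt_irrefl _ h₃
      · have := mul_pos h₁' k₃
        linarith
    have e₃ : x₃ = 0 := by
      have : x₃ * y₂ ≤ 0 := by linarith
      nlinarith
    subst e₁ e₃
    linarith

theorem orientation2D_rotate (p q r : ℝ × ℝ) : orientation2D q r p = orientation2D p q r := by
  unfold orientation2D; ring

theorem orientation2D_swap (p q r : ℝ × ℝ) : orientation2D p r q = - orientation2D p q r := by
  unfold orientation2D; ring

theorem lexLt.sub_pos {p q : ℝ × ℝ} (h : lexLt p q) :
    0 < q.1 - p.1 ∨ (0 = q.1 - p.1 ∧ 0 < q.2 - p.2) := by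
  rcases h with h | ⟨h, h'⟩
  · exact Or.inl (by linarith)
  · exact Or.inr ⟨by linarith, by linarith⟩

/-- Two successive right turns of a monotone chain make right turns at its end points. -/
theorem turn_trans {d : Bool} {a b c e : ℝ × ℝ} (hab : dirLt d a b) (hbc : dirLt d b c)
    (hce : dirLt d c e) (h₁ : orientation2D a b c < 0) (h₂ : orientation2D b c e < 0) :
    orientation2D a b e < 0 ∧ orientation2D a c e < 0 := by
  unfold orientation2D at *
  cases d
  · have := cross_neg_trans (lexLt.sub_pos hab) (lexLt.sub_pos hbc) (lexLt.sub_pos hce)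
      (by linarith) (by linarith)
    constructor <;> linarith
  · have := cross_neg_trans (lexLt.sub_pos hab) (lexLt.sub_pos hbc) (lexLt.sub_pos hce)
      (by linarith) (by linarith)
    constructor <;> linarith

/-- If both ends of a monotone left turn `a r b` are not to the left of the line `p q`, then
its middle is strictly to the right of that line. -/
theorem turn_of_ends {d : Bool} {a b p q r : ℝ × ℝ} (har : dirLt d a r) (hrb : dirLt d r b)
    (hpq : dirLt d p q) (h : 0 < orientation2D a r b) (ha : orientation2D p q a ≤ 0)
    (hb : orientation2D p q b ≤ 0) : orientation2D p q r < 0 := by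
  -- Otherwise the directions `r → b`, `p → q`, `a → r` are successively not clockwise from one
  -- another, and transitivity makes `a r b` no left turn.
  by_contra! hr
  unfold orientation2D at *
  cases d
  · have := cross_nonneg_trans (lexLt.sub_pos hrb) (lexLt.sub_pos hpq) (lexLt.sub_pos har)
      (by linarith) (by linarith)
    linarith
  · have := cross_nonneg_trans (lexLt.sub_pos hrb) (lexLt.sub_pos hpq) (lexLt.sub_pos har)
      (by linarith) (by linarith)
    linarith

/-! ### Monotone chains: from local to global right turns -/

/-- A list of points, latest first, that is monotone in direction `d` and turns right at each of
its inner points. -/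
def TurnChain (d : Bool) : List (ℝ × ℝ) → Prop
  | u :: a :: l => dirLt d a u ∧ (∀ b ∈ l.head?, orientation2D b a u < 0) ∧ TurnChain d (a :: l)
  | _ => True

theorem TurnChain.tail {d : Bool} {u : ℝ × ℝ} {l : List (ℝ × ℝ)} (h : TurnChain d (u :: l)) :
    TurnChain d l := by
  cases l with
  | nil => trivial
  | cons a l => exact h.2.2

theorem TurnChain.pairwise {d : Bool} {l : List (ℝ × ℝ)} (h : TurnChain d l) :
    l.Pairwise fun u a => dirLt d a u := by
  induction l with
  | nil => simp
  | cons u l ih =>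
    have ih := ih h.tail
    refine List.pairwise_cons.2 ⟨?_, ih⟩
    cases l with
    | nil => simp
    | cons a l =>
      intro x hx
      rcases List.mem_cons.1 hx with rfl | hx
      · exact h.1
      · exact dirLt_trans ((List.pairwise_cons.1 ih).1 x hx) h.1

/-- Right turns at consecutive triples spread to all triples by `turn_trans`: first with the two
latest points fixed, then with only the latest one fixed. -/
theorem TurnChain.triplewise {d : Bool} {l : List (ℝ × ℝ)} (h : TurnChain d l) :
    l.Triplewise fun u a b => orientation2D b a u < 0 := by
  induction l with
  | nil => simp
  | cons u l ih =>
    have ih := ih h.tail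
    refine List.triplewise_cons.2 ⟨?_, ih⟩
    have hp := h.tail.pairwise
    cases l with
    | nil => simp
    | cons a l =>
      have hal := List.pairwise_cons.1 hp
      have hf : ∀ y ∈ l, orientation2D y a u < 0 := by
        cases l with
        | nil => simp
        | cons b l =>
          intro y hy
          have hb : orientation2D b a u < 0 := h.2.1 b (by simp)
          rcases List.mem_cons.1 hy with rfl | hy
          · exact hb
          · have h3 := List.pairwise_cons.1 (List.triplewise_cons.1 ih).1
            exact (turn_trans ((List.pairwise_cons.1 hal.2).1 y hy) (hal.1 b (by simp)) h.1
              (h3.1 y hy) hb).2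
      refine List.pairwise_cons.2 ⟨hf, ?_⟩
      have h2 := (List.triplewise_cons.1 ih).1
      refine List.Pairwise.imp_of_mem ?_ (hal.2.and h2)
      rintro x y hx hy ⟨hxy, ht⟩
      exact (turn_trans hxy (hal.1 x hx) h.1 ht (hf x hx)).1

/-! ### Hull chains and their opposite chains -/

/-- `O` is a chain of points of `S` that is monotone in direction `d`, turns right, and passes
weakly to the left of all other points of `S`. -/
structure IsHullChain (d : Bool) (S : Set (ℝ × ℝ)) (O : List (ℝ × ℝ)) : Prop where
  subset : ∀ p ∈ O, p ∈ S
  sorted : O.Pairwise (dirLt d)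
  turn : O.Triplewise fun p q r => orientation2D p q r < 0
  cover : ∀ p ∈ S, p ∈ O ∨ ∃ a ∈ S, ∃ b ∈ S, dirLt d a p ∧ dirLt d p b ∧ 0 ≤ orientation2D a p b

theorem exists_dirLt_min (d : Bool) {S : Set (ℝ × ℝ)} (hS : S.Finite) (hne : S.Nonempty) :
    ∃ a ∈ S, ∀ p ∈ S, p = a ∨ dirLt d a p := by
  lift S to Finset (ℝ × ℝ) using hS
  induction hne using Finset.Nonempty.cons_induction with
  | singleton a => exact ⟨a, by simp, by simp⟩
  | cons a s ha hs ih =>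
    obtain ⟨b, hb, hmin⟩ := ih
    simp only [Finset.coe_cons, Set.mem_insert_iff, Finset.mem_coe] at *
    rcases dirLt_total d a b with h | rfl | h
    · refine ⟨a, Or.inl rfl, ?_⟩
      rintro p (rfl | hp)
      · exact Or.inl rfl
      · rcases hmin p hp with rfl | h'
        exacts [Or.inr h, Or.inr (dirLt_trans h h')]
    · exact absurd hb ha
    · refine ⟨b, Or.inr hb, ?_⟩
      rintro p (rfl | hp)
      exacts [Or.inr h, hmin p hp]

/-- An extreme point of the order is not strictly between two points of `S`, so no segment can cover
it and it must be listed; sortedness then forces it to an end of the list. -/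
theorem IsHullChain.exists_eq_cons_append {d : Bool} {S : Set (ℝ × ℝ)} {O : List (ℝ × ℝ)}
    (hO : IsHullChain d S O) {lo hi : ℝ × ℝ} (hloS : lo ∈ S) (hhiS : hi ∈ S)
    (hlo : ∀ p ∈ S, p = lo ∨ dirLt d lo p) (hhi : ∀ p ∈ S, p = hi ∨ dirLt d p hi)
    (hne : lo ≠ hi) : ∃ M, O = lo :: (M ++ [hi]) := by
  have hlo' : ∀ p ∈ S, ¬ dirLt d p lo := fun p hp h => (hlo p hp).elim
    (fun e => dirLt_irrefl d lo (e ▸ h)) fun h' => dirLt_irrefl d lo (dirLt_trans h' h)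
  have hhi' : ∀ p ∈ S, ¬ dirLt d hi p := fun p hp h => (hhi p hp).elim
    (fun e => dirLt_irrefl d hi (e ▸ h)) fun h' => dirLt_irrefl d hi (dirLt_trans h h')
  have hloO : lo ∈ O := (hO.cover lo hloS).resolve_right
    fun ⟨a, ha, _, _, h, _⟩ => hlo' a ha h
  have hhiO : hi ∈ O := (hO.cover hi hhiS).resolve_right
    fun ⟨_, _, b, hb, _, h, _⟩ => hhi' b hb h
  have hsub := hO.subset
  have hsort := hO.sorted
  obtain ⟨X, Y, rfl⟩ := List.append_of_mem hloO
  obtain rfl : X = [] := by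
    refine List.eq_nil_iff_forall_not_mem.2 fun x hx => hlo' x (hsub x (by simp [hx])) ?_
    exact (List.pairwise_append.1 hsort).2.2 x hx lo (by simp)
  have hhiY : hi ∈ Y := by simpa [hne.symm] using hhiO
  obtain ⟨Z, W, rfl⟩ := List.append_of_mem hhiY
  obtain rfl : W = [] := by
    refine List.eq_nil_iff_forall_not_mem.2 fun x hx => hhi' x (hsub x (by simp [hx])) ?_
    simp only [List.nil_append, List.pairwise_cons, List.pairwise_append] at hsort
    exact hsort.2.2.1.1 x hx
  exact ⟨Z, rfl⟩

/-- A point `r` of the opposite chain is strictly on the other side of the segment from `lo` to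
`hi`, whose ends are weakly right of every line `p q` through the chain; `turn_of_ends` then
applies. These are the mixed triples needed when the chains are glued. -/
theorem turn_of_mem_opposite {d : Bool} {S T : Set (ℝ × ℝ)} {M M' : List (ℝ × ℝ)}
    {lo hi : ℝ × ℝ} (hO : IsHullChain d S (lo :: (M ++ [hi])))
    (hD : IsHullChain (!d) T (hi :: (M' ++ [lo]))) {r : ℝ × ℝ} (hr : r ∈ hi :: M') :
    (lo :: M).Pairwise fun p q => orientation2D p q r < 0 := by
  have hturn := hO.turn
  rw [← List.cons_append, List.triplewise_append] at hturn
  have hsort := hO.sorted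
  rw [← List.cons_append, List.pairwise_append] at hsort
  rcases List.mem_cons.1 hr with rfl | hr
  · exact hturn.2.2.2 r (by simp)
  have hDt := (List.triplewise_cons.1 hD.turn).1
  have hDs := List.pairwise_cons.1 hD.sorted
  have h₁ : 0 < orientation2D lo r hi := by
    have := (List.pairwise_append.1 hDt).2.2 r hr lo (by simp)
    have e : orientation2D hi r lo = - orientation2D lo r hi := by unfold orientation2D; ring
    linarith
  have h₂ : dirLt d r hi := (dirLt_not d hi r).1 (hDs.1 r (by simp [hr]))
  have h₃ : dirLt d lo r :=
    (dirLt_not d r lo).1 ((List.pairwise_append.1 hDs.2).2.2 r hr lo (by simp))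
  have h₄ : (lo :: M).Pairwise fun p q => orientation2D p q lo ≤ 0 := by
    refine List.pairwise_cons.2 ⟨fun q _ => ?_, ?_⟩
    · unfold orientation2D; apply le_of_eq; ring
    · refine (List.triplewise_cons.1 hturn.1).1.imp fun {p q} h => ?_
      rw [orientation2D_rotate]
      exact h.le
  refine List.Pairwise.imp ?_ ((hsort.1.and h₄).and (hturn.2.2.2 hi (by simp)))
  rintro p q ⟨⟨h, h'⟩, h''⟩
  exact turn_of_ends h₃ h₂ h h₁ h' h''.le

/-! ### Separation, extreme points and the glued list -/

theorem convex_setOf_orientation2D_nonneg (p q : ℝ × ℝ) :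
    Convex ℝ {z | 0 ≤ orientation2D p q z} := by
  intro x hx y hy a b ha hb hab
  simp only [Set.mem_ofPred_eq, orientation2D, Prod.fst_add, Prod.snd_add, Prod.smul_fst,
    Prod.smul_snd, smul_eq_mul] at *
  have := mul_nonneg ha hx
  have := mul_nonneg hb hy
  obtain rfl : b = 1 - a := by linarith
  linarith

/-- A point of a list that turns right throughout is outside the hull of the other ones. -/
theorem not_mem_convexHull_of_triplewise {X Y : List (ℝ × ℝ)} {u : ℝ × ℝ}
    (hnd : (X ++ u :: Y).Nodup)
    (h : (X ++ u :: Y).Triplewise fun p q r => orientation2D p q r < 0) :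
    u ∉ convexHull ℝ {z | z ∈ Y ++ X} := by
  -- Orientation is invariant under cyclic shifts, so the list may be rotated to start at `u`; its
  -- cyclic neighbours are then the first and the last of the other points.
  have hrot : (u :: (Y ++ X)).Triplewise fun p q r => orientation2D p q r < 0 := by
    rw [List.triplewise_append, List.triplewise_cons] at h
    obtain ⟨hX, ⟨hY, hY'⟩, h₁, h₂⟩ := h
    rw [List.triplewise_cons, List.triplewise_append, List.pairwise_append]
    refine ⟨⟨hY, (h₂ u (by simp)).imp fun {p q} h => ?_, fun y hy x hx => ?_⟩, hY', hX,
      fun y hy => (h₂ y (by simp [hy])).imp fun {p q} h => ?_,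
      fun x hx => (List.pairwise_cons.1 (h₁ x hx)).2.imp fun {p q} h => ?_⟩
    · rwa [← orientation2D_rotate]
    · rw [orientation2D_rotate]
      exact (List.pairwise_cons.1 (h₁ x hx)).1 y hy
    · rwa [← orientation2D_rotate]
    · rwa [orientation2D_rotate]
  have hu : u ∉ Y ++ X := by
    rw [List.nodup_middle] at hnd
    have := (List.nodup_cons.1 hnd).1
    simp only [List.mem_append] at *
    tauto
  generalize Y ++ X = R at hrot hu
  rcases List.eq_nil_or_concat R with rfl | ⟨R, p, rfl⟩
  · simp
  rw [List.concat_eq_append] at hrot hu ⊢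
  cases R with
  | nil => simpa using hu
  | cons q R =>
    intro hmem
    obtain ⟨hpw, ht⟩ := List.triplewise_cons.1 hrot
    simp only [List.cons_append, List.pairwise_cons, List.triplewise_cons,
      List.pairwise_append] at hpw ht
    -- The line through the two neighbours of `u` separates it from all other points.
    have hsub : {z | z ∈ q :: R ++ [p]} ⊆ {z | 0 ≤ orientation2D q p z} := by
      intro z hz
      simp only [List.cons_append, List.mem_cons, List.mem_append, List.not_mem_nil, or_false,
        Set.mem_ofPred_eq] at hz ⊢
      rcases hz with rfl | hz | rfl
      · unfold orientation2D; apply le_of_eq; ring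
      · have := ht.1.2.2 z hz p (by simp)
        rw [orientation2D_swap]
        linarith
      · unfold orientation2D; apply le_of_eq; ring
    have h₁ := convexHull_min hsub (convex_setOf_orientation2D_nonneg q p) hmem
    have h₂ := hpw.1 p (by simp)
    have h₃ : orientation2D q p u = orientation2D u q p := orientation2D_rotate u q p
    have h₄ : 0 ≤ orientation2D q p u := h₁
    linarith

/-- If a functional that does not decrease upwards is larger at `u` than at `a` and at `b`, then `u`
lies above the segment `a b`. -/
theorem turn_of_linear_lt {α β : ℝ} {a u b : ℝ × ℝ} (hau : lexLt a u) (hub : lexLt u b)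
    (hβ : 0 ≤ β) (ha : α * a.1 + β * a.2 < α * u.1 + β * u.2)
    (hb : α * b.1 + β * b.2 < α * u.1 + β * u.2) : orientation2D a u b < 0 := by
  by_contra! h
  unfold orientation2D at h
  have h₁ := lexLt.sub_pos hau
  have h₂ := lexLt.sub_pos hub
  have hx : (b.1 - u.1) * (α * (u.1 - a.1) + β * (u.2 - a.2)) +
      (u.1 - a.1) * - (α * (b.1 - u.1) + β * (b.2 - u.2)) =
      - (β * ((u.1 - a.1) * (b.2 - a.2) - (u.2 - a.2) * (b.1 - a.1))) := by ring
  have := mul_nonneg hβ h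
  have k₁ : 0 < α * (u.1 - a.1) + β * (u.2 - a.2) := by linarith
  have k₂ : 0 < - (α * (b.1 - u.1) + β * (b.2 - u.2)) := by linarith
  rcases h₁ with h₁ | ⟨h₁, h₁'⟩
  · have := mul_pos h₁ k₂
    have : 0 ≤ b.1 - u.1 := by grind
    have := mul_nonneg this k₁.le
    linarith
  · have e : (u.1 - a.1) * - (α * (b.1 - u.1) + β * (b.2 - u.2)) = 0 := by rw [← h₁, zero_mul]
    rcases h₂ with h₂ | ⟨h₂, h₂'⟩
    · have := mul_pos h₂ k₁
      linarith
    · rw [← h₂] at k₂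
      have := mul_nonneg hβ h₂'.le
      linarith

/-- A vertex of the hull is not weakly below one and weakly above another segment of a
finite set of points. -/
theorem not_mem_extremePoints {S : Set (ℝ × ℝ)} (hS : S.Finite) {a u b a' b' : ℝ × ℝ}
    (ha : a ∈ S) (hb : b ∈ S) (hau : lexLt a u) (hub : lexLt u b)
    (h : 0 ≤ orientation2D a u b) (ha' : a' ∈ S) (hb' : b' ∈ S) (hau' : lexLt u a')
    (hub' : lexLt b' u) (h' : 0 ≤ orientation2D a' u b') :
    u ∉ (convexHull ℝ S).extremePoints ℝ := by
  intro hu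
  have hu' : u ∉ convexHull ℝ (S \ {u}) := fun hmem =>
    ((convex_convexHull ℝ S).mem_extremePoints_iff_mem_sdiff_convexHull_sdiff.1 hu).2
      (convexHull_mono (Set.sdiff_subset_sdiff_left (subset_convexHull ℝ S)) hmem)
  have hcl : IsClosed (convexHull ℝ (S \ {u})) :=
    ((hS.subset Set.sdiff_subset).isCompact_convexHull ℝ).isClosed
  -- An extreme point is the strict maximum of some linear functional. The sign of its second
  -- coefficient decides which of the two segments is contradicted.
  obtain ⟨f, v, hf, hv⟩ := geometric_hahn_banach_closed_point (convex_convexHull ℝ _) hcl hu'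
  have hfe : ∀ z : ℝ × ℝ, f z = f (1, 0) * z.1 + f (0, 1) * z.2 := by
    intro z
    have : z = z.1 • ((1, 0) : ℝ × ℝ) + z.2 • ((0, 1) : ℝ × ℝ) := by
      ext <;> simp
    conv_lhs => rw [this]
    rw [map_add, map_smul, map_smul, smul_eq_mul, smul_eq_mul, mul_comm, mul_comm z.2]
  have key : ∀ z ∈ S, z ≠ u →
      f (1, 0) * z.1 + f (0, 1) * z.2 < f (1, 0) * u.1 + f (0, 1) * u.2 := by
    intro z hz hne
    rw [← hfe, ← hfe]
    exact (hf z (subset_convexHull ℝ _ ⟨hz, hne⟩)).trans hv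
  have hne : ∀ {p q}, lexLt p q → p ≠ q := fun {p q} h e => lexLt_irrefl q (e ▸ h)
  rcases le_total 0 (f (0, 1)) with hβ | hβ
  · have := turn_of_linear_lt hau hub hβ (key a ha (hne hau)) (key b hb (hne hub).symm)
    linarith
  -- A point reflection reverses the order, preserves orientation, and reduces this case to the
  -- previous one.
  · have hneg : ∀ {p q}, lexLt p q → lexLt (-q) (-p) := by
      intro p q h
      unfold lexLt at *
      simp only [Prod.fst_neg, Prod.snd_neg]
      grind
    have k₁ := key a' ha' (hne hau').symm
    have k₂ := key b' hb' (hne hub')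
    have := turn_of_linear_lt (α := - f (1, 0)) (β := - f (0, 1)) (hneg hau') (hneg hub')
      (by linarith) (by simpa using k₁) (by simpa using k₂)
    have e : orientation2D (-a') (-u) (-b') = orientation2D a' u b' := by
      simp only [orientation2D, Prod.fst_neg, Prod.snd_neg]; ring
    linarith

/-- A listed point that is not extreme would, by Krein–Milman, be in the hull of the extreme points
and hence of the other listed points, which the right turns exclude. -/
theorem isConvexHullList_of_forall_mem {S : Set (ℝ × ℝ)} (hS : S.Finite) {L : List (ℝ × ℝ)}
    (hLS : ∀ p ∈ L, p ∈ S) (hnd : L.Nodup)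
    (hturn : L.Triplewise fun p q r => orientation2D p q r < 0)
    (hext : ∀ p ∈ (convexHull ℝ S).extremePoints ℝ, p ∈ L) : IsConvexHullList S L := by
  refine ⟨hnd, fun p => ⟨fun hp => ?_, hext p⟩, hturn⟩
  by_contra hnot
  obtain ⟨X, Y, rfl⟩ := List.append_of_mem hp
  refine not_mem_convexHull_of_triplewise hnd hturn ?_
  have hsub : (convexHull ℝ S).extremePoints ℝ ⊆ {z | z ∈ Y ++ X} := by
    intro z hz
    have hzp : z ≠ p := fun e => hnot (e ▸ hz)
    have := hext z hz
    simp only [List.mem_append, List.mem_cons, Set.mem_ofPred_eq] at *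
    tauto
  have hKM := closure_convexHull_extremePoints (hS.isCompact_convexHull ℝ) (convex_convexHull ℝ S)
  have hfin : ((convexHull ℝ S).extremePoints ℝ).Finite :=
    hS.subset extremePoints_convexHull_subset
  rw [(hfin.isCompact_convexHull ℝ).isClosed.closure_eq] at hKM
  have : p ∈ convexHull ℝ ((convexHull ℝ S).extremePoints ℝ) := by
    rw [hKM]
    exact subset_convexHull ℝ S (hLS p hp)
  exact convexHull_mono hsub this

/-- The chains share exactly their two end points, and dropping the last point of each leaves either
end once. An extreme point must be on one of them, since otherwise it would be covered from both
sides. -/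
theorem isConvexHullList_of_chains {S : Set (ℝ × ℝ)} (hS : S.Finite) (hnt : S.Nontrivial)
    {O D : List (ℝ × ℝ)} (hO : IsHullChain true S O) (hD : IsHullChain false S D) :
    IsConvexHullList S (O.dropLast ++ D.dropLast) := by
  obtain ⟨lo, hloS, hlo⟩ := exists_dirLt_min true hS hnt.nonempty
  obtain ⟨hi, hhiS, hhi⟩ := exists_dirLt_min false hS hnt.nonempty
  have hne : lo ≠ hi := by
    rintro rfl
    refine hnt.not_subsingleton fun p hp q hq => ?_
    have : ∀ p ∈ S, p = lo := fun p hp => (hlo p hp).elim id fun h => (hhi p hp).elim id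
      fun h' => absurd (lexLt_trans h h') (lexLt_irrefl _)
    rw [this p hp, this q hq]
  obtain ⟨M, rfl⟩ := hO.exists_eq_cons_append hloS hhiS hlo hhi hne
  obtain ⟨M', rfl⟩ := hD.exists_eq_cons_append hhiS hloS hhi hlo hne.symm
  rw [← List.cons_append, ← List.cons_append, List.dropLast_concat, List.dropLast_concat]
  have hOt := hO.turn
  have hDt := hD.turn
  have hOs := hO.sorted
  have hDs := hD.sorted
  rw [← List.cons_append, List.triplewise_append] at hOt hDt
  rw [← List.cons_append, List.pairwise_append] at hOs hDs
  have hnd : ∀ {d : Bool} {l : List (ℝ × ℝ)}, l.Pairwise (dirLt d) → l.Nodup :=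
    fun {d} {l} h => List.Pairwise.imp (S := fun p q => p ≠ q)
      (fun {p q} h e => dirLt_irrefl d p (by rwa [← e] at h)) h
  have hmix₁ : ∀ r ∈ hi :: M', (lo :: M).Pairwise fun p q => orientation2D p q r < 0 :=
    fun r hr => turn_of_mem_opposite (d := true) hO hD hr
  have hmix₂ : ∀ r ∈ lo :: M, (hi :: M').Pairwise fun p q => orientation2D p q r < 0 :=
    fun r hr => turn_of_mem_opposite (d := false) hD hO hr
  refine isConvexHullList_of_forall_mem hS ?_ ?_ ?_ ?_
  · intro p hp
    rcases List.mem_append.1 hp with hp | hp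
    · exact hO.subset p (by simp at *; tauto)
    · exact hD.subset p (by simp at *; tauto)
  · refine List.nodup_append.2 ⟨hnd hOs.1, hnd hDs.1, ?_⟩
    rintro p hp _ hq rfl
    have hphi : dirLt true p hi := hOs.2.2 p hp hi (by simp)
    have hplo : dirLt false p lo := hDs.2.2 p hq lo (by simp)
    have hpM : p ∈ M := by
      rcases List.mem_cons.1 hp with rfl | hp
      exacts [absurd hplo (dirLt_irrefl _ _), hp]
    have hpM' : p ∈ M' := by
      rcases List.mem_cons.1 hq with rfl | hq
      exacts [absurd hphi (dirLt_irrefl _ _), hq]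
    have h₁ := (List.pairwise_cons.1 (hOt.2.2.2 hi (by simp))).1 p hpM
    have h₂ := (List.pairwise_cons.1 (hDt.2.2.2 lo (by simp))).1 p hpM'
    have e : orientation2D hi p lo = - orientation2D lo p hi := by unfold orientation2D; ring
    linarith
  · refine List.triplewise_append.2 ⟨hOt.1, hDt.1, fun p hp => ?_, hmix₁⟩
    refine (hmix₂ p hp).imp fun {q r} h => ?_
    rwa [← orientation2D_rotate]
  · intro p hp
    have hpS := extremePoints_convexHull_subset hp
    rcases hO.cover p hpS with h | ⟨a, ha, b, hb, h₁, h₂, h₃⟩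
    · simp only [List.mem_append, List.mem_cons, List.not_mem_nil, or_false] at *
      tauto
    rcases hD.cover p hpS with h | ⟨a', ha', b', hb', h₁', h₂', h₃'⟩
    · simp only [List.mem_append, List.mem_cons, List.not_mem_nil, or_false] at *
      tauto
    exact absurd hp (not_mem_extremePoints hS ha hb h₁ h₂ h₃ ha' hb' h₁' h₂' h₃')

theorem isConvexHullList_singleton (p : ℝ × ℝ) : IsConvexHullList {p} [p] :=
  ⟨by simp, by simp, by simp⟩

/-- With a single distinct point both passes report nothing, which is why the program treats this
case separately. -/
theorem IsHullChain.dropLast_eq_nil {d : Bool} {p : ℝ × ℝ} {L : List (ℝ × ℝ)}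
    (h : IsHullChain d {p} L) : L.dropLast = [] := by
  have hsort := h.sorted
  rcases L with _ | ⟨a, _ | ⟨b, L⟩⟩
  · rfl
  · rfl
  · have h₁ : a = p := h.subset a (by simp)
    have h₂ : b = p := h.subset b (by simp)
    rw [h₁, h₂] at hsort
    exact absurd ((List.pairwise_cons.1 hsort).1 p (by simp)) (dirLt_irrefl d p)

end PlanarHull

/-! ### Total correctness with running times -/

namespace PointRAM

variable {k m n : ℕ} {P : Fin n → ℝ × ℝ} {s w : ℕ}

/-- The program `p` started in `σ` halts without a fault after some number `t` of steps in some
state `τ` such that `Q t τ`. -/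
def WP (P : Fin n → ℝ × ℝ) (s w : ℕ) (p : Prog k m) (σ : State k m)
    (Q : ℕ → State k m → Prop) : Prop :=
  ∃ t τ, Exec P s w p σ t τ ∧ Q t τ

theorem WP.mono {p : Prog k m} {σ : State k m} {Q Q' : ℕ → State k m → Prop}
    (h : WP P s w p σ Q) (hQ : ∀ t τ, Q t τ → Q' t τ) : WP P s w p σ Q' := by
  obtain ⟨t, τ, he, hq⟩ := h
  exact ⟨t, τ, he, hQ t τ hq⟩

theorem wp_skip {σ : State k m} {Q : ℕ → State k m → Prop} :
    WP P s w Prog.skip σ Q ↔ Q 1 σ := by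
  constructor
  · rintro ⟨t, τ, h, hq⟩
    cases h
    exact hq
  · exact fun h => ⟨_, _, Exec.skip σ, h⟩

theorem wp_assign {σ : State k m} {r : Fin k} {e : WExp k} {Q : ℕ → State k m → Prop} :
    WP P s w (Prog.assign r e) σ Q ↔ e.eval n σ.reg < w ∧
      Q (e.cost + 1) { σ with reg := Function.update σ.reg r (e.eval n σ.reg) } := by
  constructor
  · rintro ⟨t, τ, h, hq⟩
    cases h with
    | assign _ _ _ hw => exact ⟨hw, hq⟩
  · exact fun h => ⟨_, _, Exec.assign σ r e h.1, h.2⟩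

theorem wp_load {σ : State k m} {r : Fin k} {a : Fin m} {i : WExp k}
    {Q : ℕ → State k m → Prop} :
    WP P s w (Prog.load r a i) σ Q ↔ i.eval n σ.reg < s ∧
      Q (i.cost + 1) { σ with reg := Function.update σ.reg r (σ.arr a (i.eval n σ.reg)) } := by
  constructor
  · rintro ⟨t, τ, h, hq⟩
    cases h with
    | load _ _ _ _ hi => exact ⟨hi, hq⟩
  · exact fun h => ⟨_, _, Exec.load σ r a i h.1, h.2⟩

theorem wp_store {σ : State k m} {a : Fin m} {i e : WExp k} {Q : ℕ → State k m → Prop} :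
    WP P s w (Prog.store a i e) σ Q ↔ i.eval n σ.reg < s ∧ e.eval n σ.reg < w ∧
      Q (i.cost + e.cost + 1) { σ with
        arr := Function.update σ.arr a
          (Function.update (σ.arr a) (i.eval n σ.reg) (e.eval n σ.reg)) } := by
  constructor
  · rintro ⟨t, τ, h, hq⟩
    cases h with
    | store _ _ _ _ hi hw => exact ⟨hi, hw, hq⟩
  · exact fun h => ⟨_, _, Exec.store σ a i e h.1 h.2.1, h.2.2⟩

theorem wp_report {σ : State k m} {e : WExp k} {Q : ℕ → State k m → Prop} :
    WP P s w (Prog.report e) σ Q ↔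
      Q (e.cost + 1) { σ with out := σ.out ++ [readPoint P (e.eval n σ.reg)] } := by
  constructor
  · rintro ⟨t, τ, h, hq⟩
    cases h
    exact hq
  · exact fun h => ⟨_, _, Exec.report σ e, h⟩

theorem wp_seq {σ : State k m} {p q : Prog k m} {Q : ℕ → State k m → Prop} :
    WP P s w (Prog.seq p q) σ Q ↔
      WP P s w p σ fun t₁ τ => WP P s w q τ fun t₂ τ' => Q (t₁ + t₂) τ' := by
  constructor
  · rintro ⟨t, τ, h, hq⟩
    cases h with
    | seq h₁ h₂ => exact ⟨_, _, h₁, _, _, h₂, hq⟩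
  · rintro ⟨t₁, τ₁, h₁, t₂, τ₂, h₂, hq⟩
    exact ⟨_, _, Exec.seq h₁ h₂, hq⟩

theorem wp_ite {σ : State k m} {c : Test k} {p q : Prog k m} {Q : ℕ → State k m → Prop} :
    WP P s w (Prog.ite c p q) σ Q ↔
      (c.Holds P σ.reg → WP P s w p σ fun t τ => Q (c.cost + t) τ) ∧
      (¬ c.Holds P σ.reg → WP P s w q σ fun t τ => Q (c.cost + t) τ) := by
  constructor
  · rintro ⟨t, τ, h, hq⟩
    cases h with
    | ite_true hc h => exact ⟨fun _ => ⟨_, _, h, hq⟩, fun h => absurd hc h⟩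
    | ite_false hc h => exact ⟨fun h => absurd h hc, fun _ => ⟨_, _, h, hq⟩⟩
  · rintro ⟨h₁, h₂⟩
    by_cases hc : c.Holds P σ.reg
    · obtain ⟨t, τ, h, hq⟩ := h₁ hc
      exact ⟨_, _, Exec.ite_true hc h, hq⟩
    · obtain ⟨t, τ, h, hq⟩ := h₂ hc
      exact ⟨_, _, Exec.ite_false hc h, hq⟩

theorem Test.cost_pos (c : Test k) : 0 < c.cost := by
  cases c <;> simp [Test.cost]

/-- Loops, with an invariant `I` and a potential `μ` that pays for every iteration. -/
theorem WP.loop {c : Test k} {p : Prog k m} (I : State k m → Prop) (μ : State k m → ℕ)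
    (hstep : ∀ σ, I σ → c.Holds P σ.reg →
      WP P s w p σ fun t τ => I τ ∧ c.cost + t + μ τ ≤ μ σ)
    {σ : State k m} (hI : I σ) :
    WP P s w (Prog.loop c p) σ fun t τ =>
      I τ ∧ ¬ c.Holds P τ.reg ∧ t + μ τ ≤ μ σ + c.cost := by
  -- Every evaluation of the guard costs at least one step, so the potential drops strictly and the
  -- same bound yields both termination and running time.
  induction hN : μ σ using Nat.strong_induction_on generalizing σ with
  | _ N ih =>
    by_cases hc : c.Holds P σ.reg
    · obtain ⟨t, τ, h, hI', hμ⟩ := hstep σ hI hc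
      have hpos := c.cost_pos
      obtain ⟨t', τ', h', hI'', hc', hμ'⟩ := ih (μ τ) (by omega) hI' rfl
      exact ⟨_, _, Exec.loop_true hc h h', hI'', hc', by omega⟩
    · exact ⟨_, _, Exec.loop_false hc, hI, hc, by omega⟩

/-! ### Comparisons and turns of input points -/

open PlanarHull

/-- The point at position `a` is lexicographically smaller than the one at position `b`. -/
def lexTest (a b : WExp k) : Test k :=
  .or (.pos (.sub (.xCoord b) (.xCoord a)))
    (.and (.not (.pos (.sub (.xCoord a) (.xCoord b)))) (.pos (.sub (.yCoord b) (.yCoord a))))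

/-- The point at position `a` precedes the one at position `b` in direction `d`. -/
def dirTest (d : Bool) (a b : WExp k) : Test k := bif d then lexTest a b else lexTest b a

/-- As `dirTest`, with equal points compared by their positions. -/
def beforeTest (d : Bool) (a b : WExp k) : Test k :=
  .or (dirTest d a b) (.and (.not (dirTest d b a)) (.lt a b))

/-- The points at the positions `a, b, c` make a right turn. -/
def turnTest (a b c : WExp k) : Test k :=
  .pos (.sub (.mul (.sub (.yCoord b) (.yCoord a)) (.sub (.xCoord c) (.xCoord a)))
    (.mul (.sub (.xCoord b) (.xCoord a)) (.sub (.yCoord c) (.yCoord a))))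

/-- The order of positions that `beforeTest` decides. -/
def Before (P : Fin n → ℝ × ℝ) (d : Bool) (i j : ℕ) : Prop :=
  dirLt d (readPoint P i) (readPoint P j) ∨
    (¬ dirLt d (readPoint P j) (readPoint P i) ∧ i < j)

theorem holds_lexTest {ρ : Fin k → ℕ} {a b : WExp k} :
    (lexTest a b).Holds P ρ ↔
      lexLt (readPoint P (a.eval n ρ)) (readPoint P (b.eval n ρ)) := by
  simp only [lexTest, Test.Holds, RExp.eval, lexLt, sub_pos]
  grind

theorem holds_dirTest {d : Bool} {ρ : Fin k → ℕ} {a b : WExp k} :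
    (dirTest d a b).Holds P ρ ↔
      dirLt d (readPoint P (a.eval n ρ)) (readPoint P (b.eval n ρ)) := by
  cases d <;> simp [dirTest, dirLt, holds_lexTest]

theorem holds_beforeTest {d : Bool} {ρ : Fin k → ℕ} {a b : WExp k} :
    (beforeTest d a b).Holds P ρ ↔ Before P d (a.eval n ρ) (b.eval n ρ) := by
  simp only [beforeTest, Test.Holds, holds_dirTest, Before]

theorem holds_turnTest {ρ : Fin k → ℕ} {a b c : WExp k} :
    (turnTest a b c).Holds P ρ ↔ orientation2D (readPoint P (a.eval n ρ))
      (readPoint P (b.eval n ρ)) (readPoint P (c.eval n ρ)) < 0 := by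
  simp only [turnTest, Test.Holds, RExp.eval, orientation2D]
  constructor <;> intro h <;> linarith

theorem cost_dirTest (d : Bool) (a b : WExp k) :
    (dirTest d a b).cost = 3 * a.cost + 3 * b.cost + 15 := by
  cases d <;> simp only [dirTest, lexTest, Test.cost, RExp.cost, cond_true, cond_false] <;> ring

theorem cost_beforeTest (d : Bool) (a b : WExp k) :
    (beforeTest d a b).cost = 7 * a.cost + 7 * b.cost + 34 := by
  simp only [beforeTest, Test.cost, cost_dirTest]; ring

theorem cost_turnTest (a b c : WExp k) :
    (turnTest a b c).cost = 4 * a.cost + 2 * b.cost + 2 * c.cost + 16 := by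
  simp only [turnTest, Test.cost, RExp.cost]; ring

theorem before_irrefl (d : Bool) (i : ℕ) : ¬ Before P d i i := by
  simp [Before, dirLt_irrefl]

theorem before_trans {d : Bool} {i j l : ℕ} (h : Before P d i j) (h' : Before P d j l) :
    Before P d i l := by
  unfold Before at *
  have t := @dirLt_trans d
  have tot := dirLt_total d
  rcases h with h | ⟨h, hl⟩
  · rcases h' with h' | ⟨h', hl'⟩
    · exact Or.inl (t h h')
    · rcases tot (readPoint P j) (readPoint P l) with e | e | e
      · exact Or.inl (t h e)
      · exact Or.inl (e ▸ h)
      · exact absurd e h'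
  · rcases tot (readPoint P i) (readPoint P j) with e | e | e
    · rcases h' with h' | ⟨h', hl'⟩
      · exact Or.inl (t e h')
      · rcases tot (readPoint P j) (readPoint P l) with e' | e' | e'
        · exact Or.inl (t e e')
        · exact Or.inl (e' ▸ e)
        · exact absurd e' h'
    · rw [e]
      rcases h' with h' | ⟨h', hl'⟩
      · exact Or.inl h'
      · exact Or.inr ⟨h', by omega⟩
    · exact absurd e h

/-- Breaking ties by position makes `Before` a strict total order of positions, so repeated points
are streamed one by one. -/
theorem before_total (d : Bool) (i j : ℕ) : Before P d i j ∨ i = j ∨ Before P d j i := by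
  unfold Before
  by_cases h : dirLt d (readPoint P i) (readPoint P j)
  · exact Or.inl (Or.inl h)
  by_cases h' : dirLt d (readPoint P j) (readPoint P i)
  · exact Or.inr (Or.inr (Or.inl h'))
  rcases lt_trichotomy i j with e | e | e
  · exact Or.inl (Or.inr ⟨h', e⟩)
  · exact Or.inr (Or.inl e)
  · exact Or.inr (Or.inr (Or.inr ⟨h, e⟩))

theorem not_dirLt_of_before {d : Bool} {i j : ℕ} (h : Before P d i j) :
    ¬ dirLt d (readPoint P j) (readPoint P i) := by
  rcases h with h | h
  · exact fun h' => dirLt_irrefl d _ (dirLt_trans h h')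
  · exact h.1

end PointRAM

namespace PointRAM

open PlanarHull

variable {n : ℕ} {P : Fin n → ℝ × ℝ} {d : Bool} {S w : ℕ}

/-! ### Streaming the input in sorted order -/

/-- `g` is the first position with the property `A`, or `n` if there is none. -/
def IsFirst (P : Fin n → ℝ × ℝ) (d : Bool) (A : ℕ → Prop) (g : ℕ) : Prop :=
  (g = n ∧ ∀ i < n, ¬ A i) ∨ (g < n ∧ A g ∧ ∀ i < n, A i → ¬ Before P d i g)

theorem IsFirst.le {A : ℕ → Prop} {g : ℕ} (h : IsFirst P d A g) : g ≤ n := by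
  rcases h with h | h <;> omega

theorem IsFirst.congr {A B : ℕ → Prop} {g : ℕ} (h : IsFirst P d A g)
    (hAB : ∀ i < n, A i ↔ B i) : IsFirst P d B g := by
  rcases h with ⟨h, h'⟩ | ⟨h, h', h''⟩
  · exact Or.inl ⟨h, fun i hi => fun hB => h' i hi ((hAB i hi).2 hB)⟩
  · exact Or.inr ⟨h, (hAB g h).1 h', fun i hi hB => h'' i hi ((hAB i hi).2 hB)⟩

theorem IsFirst.union_right {A B C : ℕ → Prop} {g h : ℕ} (hg : IsFirst P d A g)
    (hh : IsFirst P d B h) (hC : ∀ i < n, C i ↔ A i ∨ B i) (hn : h < n)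
    (hlt : g = n ∨ Before P d h g) : IsFirst P d C h := by
  rcases hh with hh | ⟨-, hB, hh⟩
  · omega
  refine Or.inr ⟨hn, (hC h hn).2 (Or.inr hB), fun i hi hCi hb => ?_⟩
  rcases (hC i hi).1 hCi with hA | hB
  · rcases hg with hg | ⟨hgn, -, hg⟩
    · exact hg.2 i hi hA
    · rcases hlt with hlt | hlt
      · omega
      · exact hg i hi hA (before_trans hb hlt)
  · exact hh i hi hB hb

theorem IsFirst.union_left {A B C : ℕ → Prop} {g h : ℕ} (hg : IsFirst P d A g)
    (hh : IsFirst P d B h) (hC : ∀ i < n, C i ↔ A i ∨ B i)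
    (hlt : ¬ (h < n ∧ (g = n ∨ Before P d h g))) : IsFirst P d C g := by
  rcases hh with ⟨rfl, hh⟩ | ⟨hn, hB, hh⟩
  · exact hg.congr fun i hi => by simp [hC i hi, hh i hi]
  push Not at hlt
  obtain ⟨hne, hlt⟩ := hlt hn
  rcases hg with hg | ⟨hgn, hA, hg⟩
  · exact absurd hg.1 hne
  refine Or.inr ⟨hgn, (hC g hgn).2 (Or.inl hA), fun i hi hCi hb => ?_⟩
  rcases (hC i hi).1 hCi with hA | hB
  · exact hg i hi hA hb
  · rcases before_total (P := P) d h i with e | e | e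
    · exact hlt (before_trans e hb)
    · exact hlt (e ▸ hb)
    · exact hh i hi hB e

theorem isFirst_eq {g : ℕ} (hg : g < n) : IsFirst P d (fun i => i = g) g :=
  Or.inr ⟨hg, rfl, fun i _ h => by rw [h]; exact before_irrefl d g⟩

/-- The positions that come after `e`; all of them for `e = n`. -/
def After (P : Fin n → ℝ × ℝ) (d : Bool) (e i : ℕ) : Prop := e = n ∨ Before P d e i

/-- `M` holds the first position after `e` of each block of `S` consecutive positions. -/
def BlockFirsts (P : Fin n → ℝ × ℝ) (d : Bool) (S e : ℕ) (M : ℕ → ℕ) : Prop :=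
  ∀ q < S, IsFirst P d (fun i => i / S = q ∧ After P d e i) (M q)

/-- Advancing the stream from `e` to its successor `g` removes exactly `g` from the later positions.
-/
theorem after_iff_of_isFirst {e g : ℕ} (hg : IsFirst P d (After P d e) g) (hgn : g < n) {i : ℕ}
    (hi : i < n) : After P d e i ↔ i = g ∨ Before P d g i := by
  rcases hg with hg | ⟨-, hA, hg⟩
  · omega
  constructor
  · intro h
    rcases before_total (P := P) d i g with e | e | e
    exacts [absurd e (hg i hi h), Or.inl e, Or.inr e]
  · rintro (rfl | h)
    · exact hA
    · exact hA.imp id fun hb => before_trans hb h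

/-- Relations between the number `n` of points, the block size `S` and the word bound `w`. -/
structure Sizes (n S w : ℕ) : Prop where
  pos : 0 < n
  le_sq : n ≤ S * S
  le : S ≤ n
  lt_word : n + 1 < w
  sq_lt_word : S * S < w

/-- block size -/
local notation "rS" => (0 : Fin 10)
/-- next position of the sorted stream -/
local notation "rE" => (1 : Fin 10)
/-- height of the stack -/
local notation "rTop" => (2 : Fin 10)
local notation "rI" => (3 : Fin 10)
local notation "rG" => (4 : Fin 10)
/-- block -/
local notation "rQ" => (5 : Fin 10)
local notation "rA" => (6 : Fin 10)
local notation "rU" => (7 : Fin 10)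
/-- number of positions of the current batch -/
local notation "rCnt" => (8 : Fin 10)
local notation "rT" => (9 : Fin 10)
/-- first positions of the blocks -/
local notation "aM" => (0 : Fin 2)
/-- stack -/
local notation "aSt" => (1 : Fin 2)

local notation:40 p:41 ";;" q:40 => Prog.seq p q

/-- Store the first position after `rE` in block `rQ`. -/
def refresh (d : Bool) : Prog 10 2 :=
  .assign rI (.mul (.reg rQ) (.reg rS)) ;;
  .assign rG .len ;;
  .loop (.and (.lt (.reg rI) (.mul (.add (.reg rQ) (.lit 1)) (.reg rS))) (.lt (.reg rI) .len))
    (.ite (.and (.or (.eq (.reg rE) .len) (beforeTest d (.reg rE) (.reg rI)))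
        (.or (.eq (.reg rG) .len) (beforeTest d (.reg rI) (.reg rG))))
      (.assign rG (.reg rI)) .skip ;;
    .assign rI (.add (.reg rI) (.lit 1))) ;;
  .store aM (.reg rQ) (.reg rG)

theorem wp_refresh (hs : Sizes n S w) {σ : State 10 2} (hS : σ.reg rS = S)
    (hQ : σ.reg rQ < S) :
    WP P (S + 1) w (refresh d) σ fun t τ => t ≤ 200 * (S + 1) ∧
      (∃ g, IsFirst P d (fun i => i / S = σ.reg rQ ∧ After P d (σ.reg rE) i) g ∧
        τ.arr = Function.update σ.arr aM (Function.update (σ.arr aM) (σ.reg rQ) g)) ∧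
      τ.out = σ.out ∧ ∀ r, r ≠ rI → r ≠ rG → τ.reg r = σ.reg r := by
  obtain ⟨h0, h1, h2, h3, h4⟩ := hs
  set q := σ.reg rQ with hq
  set e := σ.reg rE with he
  have hqS : (q + 1) * S ≤ S * S := Nat.mul_le_mul_right _ hQ
  have hqS' : (q + 1) * S = q * S + S := by ring
  simp only [refresh, wp_seq, wp_assign, WExp.eval, WExp.cost]
  refine ⟨by simp [hS, ← hq]; omega, by omega, ?_⟩
  -- The invariant says that `rG` is the first later position in the scanned part of the block, with
  -- `n` standing for none. The factor 180 generously bounds one iteration.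
  refine (WP.loop (fun τ => q * S ≤ τ.reg rI ∧ τ.reg rI ≤ (q + 1) * S ∧
      IsFirst P d (fun i => (i / S = q ∧ After P d e i) ∧ i < τ.reg rI) (τ.reg rG) ∧
      τ.arr = σ.arr ∧ τ.out = σ.out ∧ ∀ r, r ≠ rI → r ≠ rG → τ.reg r = σ.reg r)
    (fun τ => 180 * ((q + 1) * S - τ.reg rI)) ?_ ?_).mono ?_
  · rintro τ ⟨i1, i2, i3, i4, i5, i6⟩ hc
    have r0 := i6 rS (by decide) (by decide)
    have r1 := i6 rE (by decide) (by decide)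
    have r5 := i6 rQ (by decide) (by decide)
    simp only [Test.Holds, WExp.eval, r0, r5, hS, ← hq] at hc
    have hdiv : τ.reg rI / S = q := by
      rw [Nat.div_eq_iff (by nlinarith)]; omega
    have hset : ∀ i < n, ((i / S = q ∧ After P d e i) ∧ i < τ.reg rI + 1 ↔
        ((i / S = q ∧ After P d e i) ∧ i < τ.reg rI) ∨ (i = τ.reg rI ∧ After P d e i)) := by
      intro i hi
      constructor
      · rintro ⟨⟨a, b⟩, c⟩
        rcases Nat.lt_succ_iff_lt_or_eq.1 c with c | c
        exacts [Or.inl ⟨⟨a, b⟩, c⟩, Or.inr ⟨c, b⟩]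
      · rintro (⟨a, c⟩ | ⟨rfl, b⟩)
        exacts [⟨a, by omega⟩, ⟨⟨hdiv, b⟩, by omega⟩]
    simp only [wp_seq, wp_ite, wp_assign, wp_skip, Test.Holds, WExp.eval, WExp.cost, Test.cost,
      holds_beforeTest, cost_beforeTest, r1, ← he]
    constructor
    · rintro ⟨ha, hb⟩
      have hf := IsFirst.union_right i3 (isFirst_eq (d := d) hc.2) (C := fun i =>
        (i / S = q ∧ After P d e i) ∧ i < τ.reg rI + 1) (fun i hi => by
          rw [hset i hi]
          exact or_congr_right ⟨fun h => h.1, fun h => ⟨h, h ▸ ha⟩⟩) hc.2 hb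
      simp only [ne_eq, Fin.reduceEq, not_false_eq_true, Function.update_self,
        Function.update_of_ne, i4, i5, true_and]
      refine ⟨by omega, by omega, ⟨by omega, by omega, hf, fun r h3 h4 => ?_⟩, by omega⟩
      rw [Function.update_of_ne h3, Function.update_of_ne h4, i6 r h3 h4]
    · intro hne
      have hf : IsFirst P d (fun i => (i / S = q ∧ After P d e i) ∧ i < τ.reg rI + 1)
          (τ.reg rG) := by
        by_cases ha : After P d e (τ.reg rI)
        · refine IsFirst.union_left i3 (isFirst_eq (d := d) hc.2) (fun i hi => ?_)
            fun h => hne ⟨ha, h.2⟩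
          rw [hset i hi]
          exact or_congr_right ⟨fun h => h.1, fun h => ⟨h, h ▸ ha⟩⟩
        · refine i3.congr fun i hi => ?_
          rw [hset i hi]
          exact ⟨Or.inl, fun h => h.elim id fun h => absurd (h.1 ▸ h.2) ha⟩
      simp only [ne_eq, Fin.reduceEq, not_false_eq_true, Function.update_self,
        Function.update_of_ne, i4, i5, true_and]
      refine ⟨by omega, ⟨by omega, by omega, hf, fun r h3 h4 => ?_⟩, by omega⟩
      rw [Function.update_of_ne h3, i6 r h3 h4]
  · simp only [ne_eq, Fin.reduceEq, not_false_eq_true, Function.update_self,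
      Function.update_of_ne, true_and, hS, ← hq, le_refl]
    refine ⟨by omega, Or.inl ⟨rfl, ?_⟩, fun r h3 h4 => ?_⟩
    · rintro i - ⟨⟨hiq, -⟩, h⟩
      have := Nat.div_mul_le_self i S
      rw [hiq] at this
      omega
    · rw [Function.update_of_ne h4, Function.update_of_ne h3]
  · rintro t τ ⟨⟨i1, i2, i3, i4, i5, i6⟩, hc, hμ⟩
    have r0 := i6 rS (by decide) (by decide)
    have r5 := i6 rQ (by decide) (by decide)
    simp only [Test.Holds, Test.cost, WExp.eval, WExp.cost, ne_eq, Fin.reduceEq,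
      not_false_eq_true, Function.update_self, Function.update_of_ne, r0, r5, hS, ← hq]
      at hc hμ
    have hg := i3.le
    simp only [wp_store, WExp.eval, WExp.cost, r5, ← hq]
    refine ⟨by omega, by omega, by omega, ⟨τ.reg rG, i3.congr fun i hi => ?_, by rw [i4]⟩, i5, i6⟩
    refine ⟨fun h => h.1, fun h => ⟨h, ?_⟩⟩
    have : i < (q + 1) * S :=
      (Nat.div_lt_iff_lt_mul (by nlinarith : 0 < S)).1 (h.1.trans_lt (Nat.lt_succ_self q))
    omega

/-- Move `rE` to the next position of the sorted stream. -/
def next (d : Bool) : Prog 10 2 :=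
  .assign rG .len ;;
  .assign rQ (.lit 0) ;;
  .loop (.lt (.reg rQ) (.reg rS))
    (.load rT aM (.reg rQ) ;;
    .ite (.and (.lt (.reg rT) .len)
        (.or (.eq (.reg rG) .len) (beforeTest d (.reg rT) (.reg rG))))
      (.assign rG (.reg rT)) .skip ;;
    .assign rQ (.add (.reg rQ) (.lit 1))) ;;
  .assign rE (.reg rG) ;;
  .ite (.lt (.reg rE) .len) (.assign rQ (.div (.reg rE) (.reg rS)) ;; refresh d) .skip

/-- Only `g` leaves the set of later positions, so the entries of all other blocks stay valid. -/
theorem BlockFirsts.update {e g h : ℕ} {M : ℕ → ℕ} (hM : BlockFirsts P d S e M)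
    (hg : IsFirst P d (After P d e) g) (hgn : g < n)
    (hh : IsFirst P d (fun i => i / S = g / S ∧ After P d g i) h) :
    BlockFirsts P d S g (Function.update M (g / S) h) := by
  intro q hq
  rcases eq_or_ne q (g / S) with rfl | hne
  · rw [Function.update_self]
    exact hh
  · rw [Function.update_of_ne hne]
    refine (hM q hq).congr fun i hi => and_congr_right fun hiq => ?_
    rw [after_iff_of_isFirst hg hgn hi]
    refine ⟨fun h => h.elim (fun h => absurd (h ▸ hiq.symm) hne) Or.inr, fun h => Or.inr ?_⟩
    exact h.elim (fun h => absurd h hgn.ne) id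

/-- The work is one comparison per block and one rescan of a block of length `S`. The value `n` of
`rE` means "before the first position" on entry but "exhausted" on exit, so the block entries are
claimed only below `n`. -/
theorem wp_next (hs : Sizes n S w) {σ : State 10 2} (hS : σ.reg rS = S)
    (hM : BlockFirsts P d S (σ.reg rE) (σ.arr aM)) :
    WP P (S + 1) w (next d) σ fun t τ => t ≤ 400 * (S + 1) ∧
      IsFirst P d (After P d (σ.reg rE)) (τ.reg rE) ∧
      (τ.reg rE < n → BlockFirsts P d S (τ.reg rE) (τ.arr aM)) ∧
      τ.arr aSt = σ.arr aSt ∧ τ.out = σ.out ∧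
      τ.reg rS = S ∧ τ.reg rTop = σ.reg rTop ∧ τ.reg rCnt = σ.reg rCnt := by
  obtain ⟨h0, h1, h2, h3, h4⟩ := id hs
  set e := σ.reg rE with he
  simp only [next, wp_seq, wp_assign, WExp.eval, WExp.cost]
  refine ⟨by omega, by omega, ?_⟩
  refine (WP.loop (fun τ => τ.reg rQ ≤ S ∧
      IsFirst P d (fun i => i / S < τ.reg rQ ∧ After P d e i) (τ.reg rG) ∧
      τ.arr = σ.arr ∧ τ.out = σ.out ∧ ∀ r, r ≠ rG → r ≠ rQ → r ≠ rT → τ.reg r = σ.reg r)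
    (fun τ => 100 * (S - τ.reg rQ)) ?_ ?_).mono ?_
  · rintro τ ⟨i1, i2, i3, i4, i5⟩ hc
    have r0 := i5 rS (by decide) (by decide) (by decide)
    simp only [Test.Holds, WExp.eval, r0, hS] at hc
    have hT := hM _ hc
    have hset : ∀ i < n, (i / S < τ.reg rQ + 1 ∧ After P d e i ↔
        (i / S < τ.reg rQ ∧ After P d e i) ∨ (i / S = τ.reg rQ ∧ After P d e i)) := by
      intro i hi
      rw [Nat.lt_succ_iff_lt_or_eq, or_and_right]
    simp only [wp_seq, wp_ite, wp_assign, wp_skip, wp_load, Test.Holds, WExp.eval, WExp.cost,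
      Test.cost, holds_beforeTest, cost_beforeTest, ne_eq, Fin.reduceEq, not_false_eq_true,
      Function.update_self, Function.update_of_ne, i3, i4, true_and]
    refine ⟨by omega, fun ⟨ha, hb⟩ => ?_, fun hne => ?_⟩
    · refine ⟨by omega, by omega, ⟨by omega, i2.union_right hT hset ha hb, fun r a b c => ?_⟩,
        by omega⟩
      rw [Function.update_of_ne b, Function.update_of_ne a, Function.update_of_ne c, i5 r a b c]
    · refine ⟨by omega, ⟨by omega, i2.union_left hT hset hne, fun r a b c => ?_⟩, by omega⟩
      rw [Function.update_of_ne b, Function.update_of_ne c, i5 r a b c]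
  · simp only [ne_eq, Fin.reduceEq, not_false_eq_true, Function.update_self,
      Function.update_of_ne, true_and, not_lt_zero, false_and]
    refine ⟨by omega, Or.inl ⟨rfl, by simp⟩, fun r a b c => ?_⟩
    rw [Function.update_of_ne b, Function.update_of_ne a]
  · rintro t τ ⟨⟨i1, i2, i3, i4, i5⟩, hc, hμ⟩
    have r0 := i5 rS (by decide) (by decide) (by decide)
    simp only [Test.Holds, Test.cost, WExp.eval, WExp.cost, Function.update_self, r0, hS]
      at hc hμ
    have hg := i2.le
    have hfirst : IsFirst P d (After P d e) (τ.reg rG) := i2.congr fun i hi =>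
      ⟨fun h => h.2, fun h => ⟨by
        have := Nat.div_lt_of_lt_mul (hi.trans_le h1)
        omega, h⟩⟩
    have r2 := i5 rTop (by decide) (by decide) (by decide)
    have r8 := i5 rCnt (by decide) (by decide) (by decide)
    simp only [wp_ite, wp_seq, wp_assign, wp_skip, Test.Holds, WExp.eval, WExp.cost, Test.cost,
      Function.update_self]
    refine ⟨by omega, fun hlt => ?_, fun hlt => ?_⟩
    · simp only [ne_eq, Fin.reduceEq, not_false_eq_true, Function.update_of_ne, r0, hS]
      have hdiv := Nat.div_lt_of_lt_mul (hlt.trans_le h1)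
      refine ⟨by omega, (wp_refresh (P := P) (d := d) hs ?_ ?_).mono ?_⟩
      · simp [r0, hS]
      · simpa using hdiv
      · rintro t' τ' ⟨j1, ⟨g, j2, j3⟩, j4, j5⟩
        simp only [ne_eq, Fin.reduceEq, not_false_eq_true, Function.update_self,
          Function.update_of_ne] at j2 j3 j4
        have k1 : τ'.reg rE = τ.reg rG := by
          rw [j5 rE (by decide) (by decide)]; simp
        refine ⟨by omega, k1 ▸ hfirst, fun _ => ?_, ?_, by rw [j4, i4], ?_, ?_, ?_⟩
        · rw [k1, j3, Function.update_self, i3]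
          exact hM.update hfirst hlt j2
        · rw [j3, i3, Function.update_of_ne (by decide)]
        · rw [j5 _ (by decide) (by decide)]; simp [r0, hS]
        · rw [j5 _ (by decide) (by decide)]; simp [r2]
        · rw [j5 _ (by decide) (by decide)]; simp [r8]
    · simp only [ne_eq, Fin.reduceEq, not_false_eq_true, Function.update_of_ne]
      exact ⟨by omega, hfirst, fun h => absurd h hlt, by rw [i3], i4, by rw [r0, hS], r2, r8⟩

/-- Start the sorted stream. -/
def start (d : Bool) : Prog 10 2 :=
  .assign rS (.lit 0) ;;
  .loop (.lt (.mul (.reg rS) (.reg rS)) .len) (.assign rS (.add (.reg rS) (.lit 1))) ;;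
  .assign rE .len ;;
  .assign rQ (.lit 0) ;;
  .loop (.lt (.reg rQ) (.reg rS)) (refresh d ;; .assign rQ (.add (.reg rQ) (.lit 1)))

/-- Minimality of `S` makes the counting loop stop at `S` exactly; filling the table then takes `S`
rescans of cost O(S). -/
theorem wp_start (hs : Sizes n S w) (hmin : ∀ k < S, k * k < n) (σ : State 10 2) :
    WP P (S + 1) w (start d) σ fun t τ => t ≤ 300 * ((S + 1) * (S + 1)) ∧ τ.reg rS = S ∧
      τ.reg rE = n ∧ BlockFirsts P d S n (τ.arr aM) ∧ τ.out = σ.out := by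
  obtain ⟨h0, h1, h2, h3, h4⟩ := id hs
  simp only [start, wp_seq, wp_assign, WExp.eval, WExp.cost]
  refine ⟨by omega, ?_⟩
  refine (WP.loop (fun τ => τ.reg rS ≤ S ∧ τ.out = σ.out)
    (fun τ => 20 * (S - τ.reg rS)) ?_ ?_).mono ?_
  · rintro τ ⟨i1, i2⟩ hc
    simp only [Test.Holds, WExp.eval] at hc
    have hlt : τ.reg rS < S := by
      refine lt_of_le_of_ne i1 fun e => ?_
      rw [e] at hc
      omega
    simp only [wp_assign, WExp.eval, WExp.cost, Test.cost, Function.update_self, i2, and_true]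
    refine ⟨?_, ?_, ?_⟩ <;> omega
  · simp
  rintro t τ ⟨⟨i1, i2⟩, hc, hμ⟩
  simp only [Test.Holds, WExp.eval, Test.cost, WExp.cost, Function.update_self] at hc hμ
  have hS : τ.reg rS = S := by
    by_contra hne
    exact hc (hmin _ (lt_of_le_of_ne i1 hne))
  refine ⟨by omega, by omega, ?_⟩
  refine (WP.loop (fun τ' => τ'.reg rS = S ∧ τ'.reg rE = n ∧ τ'.reg rQ ≤ S ∧
      (∀ q < τ'.reg rQ, IsFirst P d (fun i => i / S = q ∧ After P d n i) (τ'.arr aM q)) ∧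
      τ'.out = σ.out)
    (fun τ' => (S - τ'.reg rQ) * (250 * (S + 1))) ?_ ?_).mono ?_
  · rintro τ' ⟨j1, j2, j3, j4, j5⟩ hc'
    simp only [Test.Holds, WExp.eval, j1] at hc'
    simp only [wp_seq]
    refine (wp_refresh (P := P) (d := d) hs j1 hc').mono ?_
    rintro t₁ τ₁ ⟨l1, ⟨g, l2, l3⟩, l4, l5⟩
    have r0 := l5 rS (by decide) (by decide)
    have r1 := l5 rE (by decide) (by decide)
    have r5 := l5 rQ (by decide) (by decide)
    simp only [wp_assign, WExp.eval, WExp.cost, Test.cost, ne_eq, Fin.reduceEq,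
      not_false_eq_true, Function.update_self, Function.update_of_ne, r0, r1, r5, j1, j2, l3]
    have e : (S - τ'.reg rQ) * (250 * (S + 1)) =
        (S - (τ'.reg rQ + 1)) * (250 * (S + 1)) + 250 * (S + 1) := by
      rw [show S - τ'.reg rQ = (S - (τ'.reg rQ + 1)) + 1 by omega]; ring
    refine ⟨by omega, ⟨trivial, trivial, by omega, fun q hq => ?_, by rw [l4, j5]⟩, by omega⟩
    rcases Nat.lt_succ_iff_lt_or_eq.1 hq with hq | rfl
    · rw [Function.update_of_ne hq.ne]
      exact j4 q hq
    · rw [j2] at l2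
      rw [Function.update_self]
      exact l2
  · simp only [ne_eq, Fin.reduceEq, not_false_eq_true, Function.update_self,
      Function.update_of_ne, hS, i2, true_and, not_lt_zero]
    simp
  · rintro t' τ' ⟨⟨j1, j2, j3, j4, j5⟩, hc', hμ'⟩
    simp only [Test.Holds, WExp.eval, Test.cost, WExp.cost, Function.update_self, j1] at hc' hμ'
    refine ⟨?_, j1, j2, fun q hq => j4 q (by omega), j5⟩
    have : (S - 0) * (250 * (S + 1)) + 250 * (S + 1) = 250 * ((S + 1) * (S + 1)) := by
      rw [Nat.sub_zero]; ring
    have : (S + 1) * 1 ≤ (S + 1) * (S + 1) := Nat.mul_le_mul_left _ (by omega)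
    omega

/-! ### Positions that are still to come -/

/-- Position `i` of the input is not before `e` in the stream. -/
def Pending (P : Fin n → ℝ × ℝ) (d : Bool) (e i : ℕ) : Prop := e < n ∧ ¬ Before P d i e

theorem not_before_iff {i j : ℕ} : ¬ Before P d i j ↔ i = j ∨ Before P d j i := by
  refine ⟨(before_total d i j).resolve_left, ?_⟩
  rintro (rfl | h) h'
  exacts [before_irrefl d _ h', before_irrefl d _ (before_trans h h')]

theorem pending_next {e e' : ℕ} (he : e < n) (h : IsFirst P d (After P d e) e') {i : ℕ}
    (hi : i < n) : Pending P d e i ↔ i = e ∨ Pending P d e' i := by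
  have hAfter : After P d e i ↔ Before P d e i := or_iff_right he.ne
  rw [Pending, Pending, not_before_iff, not_before_iff, ← hAfter]
  rcases lt_or_ge e' n with hlt | hge
  · rw [after_iff_of_isFirst h hlt hi]
    tauto
  · rcases h with h | h
    · have := h.2 i hi
      simp [he, this, hge]
    · omega

theorem not_pending_next {e e' : ℕ} (he : e < n) (h : IsFirst P d (After P d e) e') :
    ¬ Pending P d e' e := by
  rintro ⟨h₁, h₂⟩
  rcases h with h | ⟨-, h, -⟩
  · omega
  · exact h₂ (h.resolve_left he.ne)

/-- The number of pending positions. -/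
noncomputable def pendingCount (P : Fin n → ℝ × ℝ) (d : Bool) (e : ℕ) : ℕ :=
  {i | i < n ∧ Pending P d e i}.ncard

theorem pendingCount_le (e : ℕ) : pendingCount P d e ≤ n := by
  have : {i | i < n ∧ Pending P d e i} ⊆ ↑(Finset.range n) := fun i hi => by simpa using hi.1
  have h := Set.ncard_le_ncard this (Finset.finite_toSet _)
  rwa [Set.ncard_coe_finset, Finset.card_range] at h

theorem pendingCount_next {e e' : ℕ} (he : e < n) (h : IsFirst P d (After P d e) e') :
    pendingCount P d e = pendingCount P d e' + 1 := by
  have hfin : {i | i < n ∧ Pending P d e' i}.Finite :=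
    (Set.finite_lt_nat n).subset fun i hi => hi.1
  rw [pendingCount, pendingCount, ← Set.ncard_insert_of_notMem _ hfin]
  · congr 1
    ext i
    simp only [Set.mem_ofPred_eq, Set.mem_insert_iff]
    constructor
    · rintro ⟨hi, hp⟩
      exact ((pending_next he h hi).1 hp).imp id fun h => ⟨hi, h⟩
    · rintro (rfl | ⟨hi, hp⟩)
      · exact ⟨he, (pending_next he h he).2 (Or.inl rfl)⟩
      · exact ⟨hi, (pending_next he h hi).2 (Or.inr hp)⟩
  · exact fun hmem => not_pending_next he h hmem.2

/-! ### The stack -/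

/-- The points on a stack of height `t`, latest first. -/
noncomputable def stackPts (P : Fin n → ℝ × ℝ) (St : ℕ → ℕ) : ℕ → List (ℝ × ℝ)
  | 0 => []
  | t + 1 => readPoint P (St t) :: stackPts P St t

theorem stackPts_congr {St St' : ℕ → ℕ} {t : ℕ} (h : ∀ j < t, St j = St' j) :
    stackPts P St t = stackPts P St' t := by
  induction t with
  | zero => rfl
  | succ t ih =>
    rw [stackPts, stackPts, h t (by omega), ih fun j hj => h j (by omega)]

theorem readPoint_mem_range {i : ℕ} (hi : i < n) : readPoint P i ∈ Set.range P := by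
  rw [readPoint, dif_pos hi]
  exact Set.mem_range_self _

/-- The point `p` is on the chain `Z` or weakly to the right of a segment of the input. -/
def Covered (P : Fin n → ℝ × ℝ) (d : Bool) (Z : List (ℝ × ℝ)) (p : ℝ × ℝ) : Prop :=
  p ∈ Z ∨ ∃ a ∈ Set.range P, ∃ b ∈ Set.range P,
    dirLt d a p ∧ dirLt d p b ∧ 0 ≤ orientation2D a p b

/-- `c` does not show that `b` is off the hull, given the earlier point `a`. -/
def Keeps (d : Bool) (a b c : ℝ × ℝ) : Prop := dirLt d b c → orientation2D a b c < 0

/-- The stack `St` of height `top`, on top of the points `O` reported already, is a chain that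
covers all positions before `e`; its lowest point is final. -/
structure StackInv (P : Fin n → ℝ × ℝ) (d : Bool) (St : ℕ → ℕ) (top e : ℕ)
    (O : List (ℝ × ℝ)) : Prop where
  pos : 0 < top
  lt : ∀ j < top, St j < n
  mem : ∀ z ∈ O, z ∈ Set.range P
  chain : TurnChain d (stackPts P St top ++ O)
  cover : ∀ i < n, ¬ Pending P d e i → Covered P d (stackPts P St top ++ O) (readPoint P i)
  order : ∀ i < n, Pending P d e i → ¬ dirLt d (readPoint P i) (readPoint P (St (top - 1)))
  base : ∀ a ∈ O.head?, ∀ i < n, Pending P d e i →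
    Keeps d a (readPoint P (St 0)) (readPoint P i)

/-- The removed point stays covered, by the segment from the point below it to the refuting point
`c`. -/
theorem StackInv.pop {St : ℕ → ℕ} {t e c : ℕ} {O : List (ℝ × ℝ)}
    (h : StackInv P d St (t + 2) e O) (hc : c < n)
    (hbad : ¬ Keeps d (readPoint P (St t)) (readPoint P (St (t + 1))) (readPoint P c)) :
    StackInv P d St (t + 1) e O := by
  have hchain := h.chain
  simp only [stackPts, List.cons_append] at hchain
  simp only [Keeps, not_forall, not_lt] at hbad
  obtain ⟨hb₁, hb₂⟩ := hbad
  refine ⟨by omega, fun j hj => h.lt j (by omega), h.mem, hchain.tail, fun i hi hp => ?_,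
    fun i hi hp hlt => ?_, h.base⟩
  · rcases h.cover i hi hp with hm | hm
    · rw [stackPts, List.cons_append, List.mem_cons] at hm
      rcases hm with hm | hm
      · right
        rw [hm]
        exact ⟨_, readPoint_mem_range (h.lt t (by omega)), _, readPoint_mem_range hc,
          hchain.1, hb₁, hb₂⟩
      · exact Or.inl hm
    · exact Or.inr hm
  · exact h.order i hi hp (dirLt_trans hlt hchain.1)

/-- Pending points never precede the top, so a point that does not follow it is a copy of it and is
already on the chain. -/
theorem StackInv.skip {St : ℕ → ℕ} {top e e' : ℕ} {O : List (ℝ × ℝ)}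
    (h : StackInv P d St top e O) (he : e < n) (he' : IsFirst P d (After P d e) e')
    (hge : ¬ dirLt d (readPoint P (St (top - 1))) (readPoint P e)) :
    StackInv P d St top e' O := by
  have hpe : Pending P d e e := ⟨he, before_irrefl d e⟩
  have hmono : ∀ i < n, Pending P d e' i → Pending P d e i :=
    fun i hi hp => (pending_next he he' hi).2 (Or.inr hp)
  refine ⟨h.pos, h.lt, h.mem, h.chain, fun i hi hp => ?_,
    fun i hi hp => h.order i hi (hmono i hi hp),
    fun a ha i hi hp => h.base a ha i hi (hmono i hi hp)⟩
  by_cases hp' : Pending P d e i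
  · have hie : i = e := ((pending_next he he' hi).1 hp').resolve_right hp
    subst hie
    left
    obtain ⟨t, rfl⟩ : ∃ t, top = t + 1 := ⟨top - 1, by have := h.pos; omega⟩
    rcases dirLt_total d (readPoint P i) (readPoint P (St t)) with hl | hl | hl
    · exact absurd hl (h.order i hi hpe)
    · rw [hl, stackPts]; simp
    · exact absurd hl hge
  · exact h.cover i hi hp'

/-- The new right turn comes from `hkeep` when two points are stacked; over a lone base it comes
from the `base` field, against the last reported point. -/
theorem StackInv.push {St : ℕ → ℕ} {top e e' : ℕ} {O : List (ℝ × ℝ)}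
    (h : StackInv P d St top e O) (he : e < n) (he' : IsFirst P d (After P d e) e')
    (hlt : dirLt d (readPoint P (St (top - 1))) (readPoint P e))
    (hkeep : 2 ≤ top →
      Keeps d (readPoint P (St (top - 2))) (readPoint P (St (top - 1))) (readPoint P e)) :
    StackInv P d (Function.update St top e) (top + 1) e' O := by
  have hpe : Pending P d e e := ⟨he, before_irrefl d e⟩
  have hmono : ∀ i < n, Pending P d e' i → Pending P d e i :=
    fun i hi hp => (pending_next he he' hi).2 (Or.inr hp)
  have hpos := h.pos
  have hst : stackPts P (Function.update St top e) (top + 1) =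
      readPoint P e :: stackPts P St top := by
    rw [stackPts, Function.update_self]
    congr 1
    exact stackPts_congr fun j hj => Function.update_of_ne hj.ne _ _
  obtain ⟨t, rfl⟩ : ∃ t, top = t + 1 := ⟨top - 1, by omega⟩
  refine ⟨by omega, fun j hj => ?_, h.mem, ?_, fun i hi hp => ?_, fun i hi hp hl => ?_,
    fun a ha i hi hp => ?_⟩
  · rcases Nat.lt_succ_iff_lt_or_eq.1 hj with hj | rfl
    · rw [Function.update_of_ne hj.ne]
      exact h.lt j hj
    · rw [Function.update_self]
      exact he
  · rw [hst, stackPts, List.cons_append, List.cons_append]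
    refine ⟨hlt, ?_, h.chain⟩
    cases t with
    | zero => exact fun b hb => h.base b hb e he hpe hlt
    | succ t =>
      intro b hb
      simp only [stackPts, List.cons_append, List.head?_cons, Option.mem_def,
        Option.some.injEq] at hb
      subst hb
      exact hkeep (by omega) hlt
  · rw [hst, List.cons_append]
    by_cases hp' : Pending P d e i
    · have hie : i = e := ((pending_next he he' hi).1 hp').resolve_right hp
      subst hie
      exact Or.inl (by simp)
    · exact (h.cover i hi hp').imp (List.mem_cons_of_mem _) id
  · rw [Nat.add_sub_cancel, Function.update_self] at hl
    have := hmono i hi hp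
    rcases before_total (P := P) d i e with hb | hb | hb
    · exact this.2 hb
    · rw [hb] at hl
      exact dirLt_irrefl d _ hl
    · exact not_dirLt_of_before hb hl
  · rw [Function.update_of_ne (by omega)]
    exact h.base a ha i hi (hmono i hi hp)

/-- The top of the stack is kept by all pending positions below `I`. -/
def TopKept (P : Fin n → ℝ × ℝ) (d : Bool) (e I : ℕ) (Z : List (ℝ × ℝ)) : Prop :=
  ∀ u a l, Z = u :: a :: l → ∀ i < n, i < I → Pending P d e i → Keeps d a u (readPoint P i)

/-- This is why the filtering scan never restarts: the right turn at the new top towards the popped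
point, followed by the right turn at the popped point towards a scanned one, gives a right turn at
the new top. -/
theorem StackInv.topKept_pop {St : ℕ → ℕ} {t e I : ℕ} {O : List (ℝ × ℝ)}
    (h : StackInv P d St (t + 2) e O) (hk : TopKept P d e I (stackPts P St (t + 2) ++ O)) :
    TopKept P d e I (stackPts P St (t + 1) ++ O) := by
  intro u a l hZ i hi hI hp hlt
  have hchain := h.chain
  have hk' := hk (readPoint P (St (t + 1))) u (a :: l)
    (by rw [stackPts, List.cons_append, hZ]) i hi hI hp
  rw [stackPts, List.cons_append, hZ] at hchain
  have hturn : orientation2D a u (readPoint P (St (t + 1))) < 0 := hchain.2.1 a (by simp)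
  rcases dirLt_total d (readPoint P (St (t + 1))) (readPoint P i) with hl | hl | hl
  · exact (turn_trans hchain.2.2.1 hchain.1 hl hturn (hk' hl)).1
  · rwa [← hl]
  · exact absurd hl (h.order i hi hp)

theorem StackInv.topKept_succ {St : ℕ → ℕ} {top e I : ℕ} {O : List (ℝ × ℝ)}
    (h : StackInv P d St top e O) (hk : TopKept P d e I (stackPts P St top ++ O))
    (hnew : 2 ≤ top → Pending P d e I →
      Keeps d (readPoint P (St (top - 2))) (readPoint P (St (top - 1))) (readPoint P I)) :
    TopKept P d e (I + 1) (stackPts P St top ++ O) := by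
  intro u a l hZ i hi hI hp
  rcases Nat.lt_succ_iff_lt_or_eq.1 hI with hI | rfl
  · exact hk u a l hZ i hi hI hp
  have hpos := h.pos
  obtain ⟨t, rfl⟩ : ∃ t, top = t + 1 := ⟨top - 1, by omega⟩
  cases t with
  | zero =>
    simp only [stackPts, List.cons_append, List.nil_append, List.cons.injEq] at hZ
    obtain ⟨rfl, rfl⟩ := hZ
    exact h.base a (by simp) i hi hp
  | succ t =>
    simp only [stackPts, List.cons_append, List.cons.injEq] at hZ
    obtain ⟨rfl, rfl, -⟩ := hZ
    exact hnew (by omega) hp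

/-- The chain itself is unchanged and only its split into stack and output moves. Once all positions
are scanned, `TopKept` is precisely the `base` condition for the old top. -/
theorem StackInv.flush {St : ℕ → ℕ} {t e : ℕ} {O : List (ℝ × ℝ)}
    (h : StackInv P d St (t + 1) e O) (hk : TopKept P d e n (stackPts P St (t + 1) ++ O)) :
    StackInv P d (Function.update St 0 (St t)) 1 e (stackPts P St t ++ O) := by
  have hst : stackPts P (Function.update St 0 (St t)) 1 ++ (stackPts P St t ++ O) =
      stackPts P St (t + 1) ++ O := by
    simp [stackPts]
  refine ⟨by omega, fun j hj => ?_, fun z hz => ?_, hst ▸ h.chain,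
    fun i hi hp => hst ▸ h.cover i hi hp, fun i hi hp => ?_, fun a ha i hi hp => ?_⟩
  · obtain rfl : j = 0 := by omega
    rw [Function.update_self]
    exact h.lt t (by omega)
  · rcases List.mem_append.1 hz with hz | hz
    · have key : ∀ t', t' ≤ t → ∀ z ∈ stackPts P St t', z ∈ Set.range P := by
        intro t' ht'
        induction t' with
        | zero => simp [stackPts]
        | succ t' ih =>
          intro z hz
          rcases List.mem_cons.1 hz with rfl | hz
          · exact readPoint_mem_range (h.lt t' (by omega))
          · exact ih (by omega) z hz
      exact key t le_rfl z hz
    · exact h.mem z hz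
  · simpa using h.order i hi hp
  · rw [Function.update_self]
    obtain ⟨l, hl⟩ : ∃ l, stackPts P St t ++ O = a :: l := by
      cases hZ : stackPts P St t ++ O with
      | nil => simp [hZ] at ha
      | cons b l =>
        rw [hZ] at ha
        simp only [List.head?_cons, Option.mem_def, Option.some.injEq] at ha
        exact ⟨l, by rw [ha]⟩
    exact hk _ a l (by rw [stackPts, List.cons_append, hl]) i hi hi hp

/-! ### The program -/

/-- The position `c` shows that `b` is off the hull, given the earlier position `a`. -/
def badTest (d : Bool) (a b c : WExp 10) : Test 10 :=
  .and (dirTest d b c) (.not (turnTest a b c))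

theorem holds_badTest {ρ : Fin 10 → ℕ} {a b c : WExp 10} :
    (badTest d a b c).Holds P ρ ↔ ¬ Keeps d (readPoint P (a.eval n ρ))
      (readPoint P (b.eval n ρ)) (readPoint P (c.eval n ρ)) := by
  simp only [badTest, Test.Holds, holds_dirTest, holds_turnTest, Keeps, not_forall, exists_prop]

theorem cost_badTest (a b c : WExp 10) :
    (badTest d a b c).cost = 4 * a.cost + 5 * b.cost + 5 * c.cost + 33 := by
  simp only [badTest, Test.cost, cost_dirTest, cost_turnTest]; ring

/-- Load the two topmost cells of the stack. -/
def loadTop : Prog 10 2 :=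
  .load rU aSt (.sub (.reg rTop) (.lit 1)) ;; .load rA aSt (.sub (.reg rTop) (.lit 2))

/-- Push up to `rS` positions of the stream. -/
def pushBatch (d : Bool) : Prog 10 2 :=
  .assign rCnt (.lit 0) ;;
  .loop (.and (.lt (.reg rE) .len) (.lt (.reg rCnt) (.reg rS)))
    (loadTop ;;
    .ite (.and (.lt (.lit 1) (.reg rTop)) (badTest d (.reg rA) (.reg rU) (.reg rE)))
      (.assign rTop (.sub (.reg rTop) (.lit 1)))
      (.ite (dirTest d (.reg rU) (.reg rE))
        (.store aSt (.reg rTop) (.reg rE) ;; .assign rTop (.add (.reg rTop) (.lit 1))) .skip ;;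
      .assign rCnt (.add (.reg rCnt) (.lit 1)) ;;
      next d))

/-- Pop what the positions still to come show to be off the hull. -/
def filterBatch (d : Bool) : Prog 10 2 :=
  .assign rI (.lit 0) ;;
  .loop (.lt (.reg rI) .len)
    (loadTop ;;
    .ite (.and (.and (.lt (.lit 1) (.reg rTop)) (.lt (.reg rE) .len))
        (.and (.not (beforeTest d (.reg rI) (.reg rE))) (badTest d (.reg rA) (.reg rU) (.reg rI))))
      (.assign rTop (.sub (.reg rTop) (.lit 1)))
      (.assign rI (.add (.reg rI) (.lit 1))))

/-- Report all of the stack but its top, which becomes the new base. -/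
def flushBatch : Prog 10 2 :=
  .assign rI (.lit 0) ;;
  .loop (.lt (.add (.reg rI) (.lit 1)) (.reg rTop))
    (.load rA aSt (.reg rI) ;; .report (.reg rA) ;; .assign rI (.add (.reg rI) (.lit 1))) ;;
  .load rU aSt (.reg rI) ;;
  .store aSt (.lit 0) (.reg rU) ;;
  .assign rTop (.lit 1)

/-- Report the hull chain in direction `d` except for its last point. -/
def pass (d : Bool) : Prog 10 2 :=
  start d ;; next d ;;
  .store aSt (.lit 0) (.reg rE) ;; .assign rTop (.lit 1) ;; next d ;;
  .loop (.lt (.reg rE) .len) (pushBatch d ;; filterBatch d ;; flushBatch)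

/-- Report point `0` if all points are equal. -/
def reportIfConstant : Prog 10 2 :=
  .assign rI (.lit 0) ;;
  .loop (.and (.lt (.reg rI) .len) (.not (.or (lexTest (.lit 0) (.reg rI))
      (lexTest (.reg rI) (.lit 0)))))
    (.assign rI (.add (.reg rI) (.lit 1))) ;;
  .ite (.lt (.reg rI) .len) .skip (.report (.lit 0))

/-- Report the vertices of the convex hull in clockwise order. -/
def hullProg : Prog 10 2 := reportIfConstant ;; pass true ;; pass false

/-! ### Correctness of the program -/

/-- The state between the steps of a pass that has reported `O`, latest first, after `out₀`. -/
structure PassInv (P : Fin n → ℝ × ℝ) (d : Bool) (S : ℕ) (out₀ O : List (ℝ × ℝ))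
    (σ : State 10 2) : Prop where
  size : σ.reg rS = S
  blocks : σ.reg rE < n → BlockFirsts P d S (σ.reg rE) (σ.arr aM)
  stack : StackInv P d (σ.arr aSt) (σ.reg rTop) (σ.reg rE) O
  out : σ.out = out₀ ++ O.reverse

theorem wp_pushBatch (hs : Sizes n S w) {out₀ O : List (ℝ × ℝ)} {σ : State 10 2}
    (h : PassInv P d S out₀ O σ) (htop : σ.reg rTop = 1) :
    WP P (S + 1) w (pushBatch d) σ fun t τ => PassInv P d S out₀ O τ ∧ τ.reg rTop ≤ S + 1 ∧
      (n ≤ τ.reg rE ∨ pendingCount P d (τ.reg rE) + S = pendingCount P d (σ.reg rE)) ∧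
      t ≤ 600 * ((S + 1) * (S + 1)) := by
  obtain ⟨h0, h1, h2, h3, h4⟩ := id hs
  simp only [pushBatch, wp_seq, wp_assign, WExp.eval, WExp.cost]
  refine ⟨by omega, ?_⟩
  have hpay : ∀ c < S, (S - c) * (590 * (S + 1)) =
      (S - (c + 1)) * (590 * (S + 1)) + 590 * (S + 1) := by
    intro c hc
    rw [show S - c = (S - (c + 1)) + 1 by omega]
    ring
  -- Pops are paid for by the stack height, and each consumed position by its own share of O(S),
  -- which includes the step of the stream.
  refine (WP.loop (fun τ => PassInv P d S out₀ O τ ∧ τ.reg rTop ≤ τ.reg rCnt + 1 ∧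
      τ.reg rCnt ≤ S ∧
      pendingCount P d (τ.reg rE) + τ.reg rCnt = pendingCount P d (σ.reg rE))
    (fun τ => (S - τ.reg rCnt) * (590 * (S + 1)) + 80 * τ.reg rTop) ?_ ?_).mono ?_
  · rintro τ ⟨i1, i2, i3, i4⟩ hc
    simp only [Test.Holds, WExp.eval, i1.size] at hc
    have hpos := i1.stack.pos
    simp only [loadTop, wp_seq, wp_ite, wp_assign, wp_skip, wp_load, wp_store, Test.Holds,
      WExp.eval, WExp.cost, Test.cost, holds_badTest, cost_badTest, holds_dirTest, cost_dirTest,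
      ne_eq, Fin.reduceEq, not_false_eq_true, Function.update_self, Function.update_of_ne]
    refine ⟨by omega, by omega, fun hbad => ?_, fun hgood => ⟨fun hlt => ?_, fun hge => ?_⟩⟩
    · obtain ⟨t, ht⟩ : ∃ t, τ.reg rTop = t + 2 := ⟨τ.reg rTop - 2, by omega⟩
      have hst := i1.stack
      rw [ht] at hst
      simp only [ht, Nat.add_sub_cancel, show t + 2 - 1 = t + 1 by omega] at hbad ⊢
      refine ⟨by omega, ⟨⟨?_, ?_, ?_, i1.out⟩, by omega, i3, i4⟩, by omega⟩
      · simpa using i1.size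
      · simpa using i1.blocks
      · simpa using hst.pop hc.1 hbad.2
    · refine ⟨by omega, by omega, by omega, by omega, ?_⟩
      refine (wp_next (P := P) (d := d) hs ?_ ?_).mono ?_
      · simpa using i1.size
      · simpa using i1.blocks hc.1
      · rintro t τ' ⟨j1, j2, j3, j4, j5, j6, j7, j8⟩
        simp only [ne_eq, Fin.reduceEq, not_false_eq_true, Function.update_self,
          Function.update_of_ne] at j2 j4 j5 j7 j8
        have hcnt := pendingCount_next hc.1 j2
        refine ⟨⟨⟨j6, j3, ?_, by rw [j5, i1.out]⟩, by omega, by omega, by omega⟩, ?_⟩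
        · rw [j4, j7]
          refine i1.stack.push hc.1 j2 hlt fun h => ?_
          by_contra hk
          exact hgood ⟨h, hk⟩
        · have := hpay (τ.reg rCnt) hc.2
          rw [j7, j8]
          omega
    · refine ⟨by omega, ?_⟩
      refine (wp_next (P := P) (d := d) hs ?_ ?_).mono ?_
      · simpa using i1.size
      · simpa using i1.blocks hc.1
      · rintro t τ' ⟨j1, j2, j3, j4, j5, j6, j7, j8⟩
        simp only [ne_eq, Fin.reduceEq, not_false_eq_true, Function.update_self,
          Function.update_of_ne] at j2 j4 j5 j7 j8
        have hcnt := pendingCount_next hc.1 j2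
        refine ⟨⟨⟨j6, j3, ?_, by rw [j5, i1.out]⟩, by omega, by omega, by omega⟩, ?_⟩
        · rw [j4, j7]
          exact i1.stack.skip hc.1 j2 hge
        · have := hpay (τ.reg rCnt) hc.2
          rw [j7, j8]
          omega
  · simp only [ne_eq, Fin.reduceEq, not_false_eq_true, Function.update_self,
      Function.update_of_ne]
    refine ⟨⟨?_, ?_, ?_, h.out⟩, by omega, by omega, by omega⟩
    · simpa using h.size
    · simpa using h.blocks
    · simpa using h.stack
  · rintro t τ ⟨⟨i1, i2, i3, i4⟩, hc, hμ⟩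
    simp only [Test.Holds, WExp.eval, i1.size] at hc
    simp only [Test.cost, WExp.cost, ne_eq, Fin.reduceEq, not_false_eq_true,
      Function.update_self, Function.update_of_ne, htop] at hμ
    refine ⟨i1, by omega, by omega, ?_⟩
    have : (S - 0) * (590 * (S + 1)) + 590 * (S + 1) = 590 * ((S + 1) * (S + 1)) := by
      rw [Nat.sub_zero]; ring
    have : (S + 1) * 1 ≤ (S + 1) * (S + 1) := Nat.mul_le_mul_left _ (by omega)
    omega

theorem wp_filterBatch (hs : Sizes n S w) {out₀ O : List (ℝ × ℝ)} {σ : State 10 2}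
    (h : PassInv P d S out₀ O σ) (htop : σ.reg rTop ≤ S + 1) :
    WP P (S + 1) w (filterBatch d) σ fun t τ => PassInv P d S out₀ O τ ∧ τ.reg rTop ≤ S + 1 ∧
      TopKept P d (τ.reg rE) n (stackPts P (τ.arr aSt) (τ.reg rTop) ++ O) ∧
      τ.reg rE = σ.reg rE ∧ t ≤ 150 * ((S + 1) * (S + 1)) := by
  obtain ⟨h0, h1, h2, h3, h4⟩ := id hs
  simp only [filterBatch, wp_seq, wp_assign, WExp.eval, WExp.cost]
  refine ⟨by omega, ?_⟩
  -- Each iteration either pops or advances `rI`, so there are at most `n` plus the stack height of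
  -- them.
  refine (WP.loop (fun τ => PassInv P d S out₀ O τ ∧ τ.reg rTop ≤ S + 1 ∧ τ.reg rI ≤ n ∧
      TopKept P d (τ.reg rE) (τ.reg rI) (stackPts P (τ.arr aSt) (τ.reg rTop) ++ O) ∧
      τ.reg rE = σ.reg rE)
    (fun τ => 140 * (n - τ.reg rI) + 140 * τ.reg rTop) ?_ ?_).mono ?_
  · rintro τ ⟨i1, i2, i3, i4, i5⟩ hc
    simp only [Test.Holds, WExp.eval] at hc
    have hpos := i1.stack.pos
    simp only [loadTop, wp_seq, wp_ite, wp_assign, wp_load, Test.Holds, WExp.eval, WExp.cost,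
      Test.cost, holds_badTest, cost_badTest, holds_beforeTest, cost_beforeTest, ne_eq,
      Fin.reduceEq, not_false_eq_true, Function.update_self, Function.update_of_ne]
    refine ⟨by omega, by omega, fun hbad => ?_, fun hgood => ?_⟩
    · obtain ⟨t, ht⟩ : ∃ t, τ.reg rTop = t + 2 := ⟨τ.reg rTop - 2, by omega⟩
      have hst := i1.stack
      rw [ht] at hst i4
      simp only [ht, Nat.add_sub_cancel, show t + 2 - 1 = t + 1 by omega] at hbad ⊢
      refine ⟨by omega, ⟨⟨?_, ?_, ?_, i1.out⟩, by omega, i3, hst.topKept_pop i4, i5⟩, by omega⟩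
      · simpa using i1.size
      · simpa using i1.blocks
      · simpa using hst.pop hc hbad.2.2
    · refine ⟨by omega, ⟨⟨?_, ?_, ?_, i1.out⟩, by omega, by omega, ?_, i5⟩, by omega⟩
      · simpa using i1.size
      · simpa using i1.blocks
      · simpa using i1.stack
      · refine i1.stack.topKept_succ i4 fun h hp => ?_
        by_contra hk
        exact hgood ⟨⟨h, hp.1⟩, hp.2, hk⟩
  · simp only [ne_eq, Fin.reduceEq, not_false_eq_true, Function.update_self,
      Function.update_of_ne]
    refine ⟨⟨?_, ?_, ?_, h.out⟩, htop, by omega, ?_, trivial⟩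
    · simpa using h.size
    · simpa using h.blocks
    · simpa using h.stack
    · intro u a l _ i _ hi
      omega
  · rintro t τ ⟨⟨i1, i2, i3, i4, i5⟩, hc, hμ⟩
    simp only [Test.Holds, WExp.eval] at hc
    simp only [Test.cost, WExp.cost, ne_eq, Fin.reduceEq, not_false_eq_true,
      Function.update_self, Function.update_of_ne] at hμ
    have hI : τ.reg rI = n := by omega
    rw [hI] at i4
    refine ⟨i1, i2, i4, i5, ?_⟩
    have : (S + 1) * (S + 1) = S * S + 2 * S + 1 := by ring
    omega

theorem wp_flushBatch (hs : Sizes n S w) {out₀ O : List (ℝ × ℝ)} {σ : State 10 2}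
    (h : PassInv P d S out₀ O σ) (htop : σ.reg rTop ≤ S + 1)
    (hk : TopKept P d (σ.reg rE) n (stackPts P (σ.arr aSt) (σ.reg rTop) ++ O)) :
    WP P (S + 1) w flushBatch σ fun t τ => (∃ O', PassInv P d S out₀ O' τ) ∧
      τ.reg rTop = 1 ∧ τ.reg rE = σ.reg rE ∧ t ≤ 50 * ((S + 1) * (S + 1)) := by
  obtain ⟨h0, h1, h2, h3, h4⟩ := id hs
  have hpos := h.stack.pos
  simp only [flushBatch, wp_seq, wp_assign, WExp.eval, WExp.cost]
  refine ⟨by omega, ?_⟩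
  refine (WP.loop (fun τ => τ.reg rI + 1 ≤ τ.reg rTop ∧
      τ.out = out₀ ++ (stackPts P (σ.arr aSt) (τ.reg rI) ++ O).reverse ∧
      τ.arr = σ.arr ∧ ∀ r, r ≠ rI → r ≠ rA → τ.reg r = σ.reg r)
    (fun τ => 30 * (τ.reg rTop - τ.reg rI)) ?_ ?_).mono ?_
  · rintro τ ⟨i1, i2, i3, i4⟩ hc
    have r2 := i4 rTop (by decide) (by decide)
    simp only [Test.Holds, WExp.eval] at hc
    simp only [wp_seq, wp_assign, wp_load, wp_report, WExp.eval, WExp.cost, Test.cost, ne_eq,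
      Fin.reduceEq, not_false_eq_true, Function.update_self, Function.update_of_ne, i2, i3,
      true_and]
    refine ⟨by omega, by omega, ⟨by omega, ?_, fun r a b => ?_⟩, by omega⟩
    · simp [stackPts]
    · rw [Function.update_of_ne a, Function.update_of_ne b, i4 r a b]
  · simp only [ne_eq, Fin.reduceEq, not_false_eq_true, Function.update_self,
      Function.update_of_ne, true_and]
    refine ⟨by omega, by simpa [stackPts] using h.out, fun r a b => ?_⟩
    rw [Function.update_of_ne a]
  · rintro t τ ⟨⟨i1, i2, i3, i4⟩, hc, hμ⟩
    have r0 := i4 rS (by decide) (by decide)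
    have r1 := i4 rE (by decide) (by decide)
    have r2 := i4 rTop (by decide) (by decide)
    simp only [Test.Holds, WExp.eval] at hc
    simp only [Test.cost, WExp.cost, ne_eq, Fin.reduceEq, not_false_eq_true,
      Function.update_self, Function.update_of_ne] at hμ
    have hst := h.stack
    have ht : σ.reg rTop = τ.reg rI + 1 := by omega
    rw [ht] at hst hk
    have hlt := hst.lt (τ.reg rI) (by omega)
    simp only [wp_load, wp_store, WExp.eval, WExp.cost, ne_eq, Fin.reduceEq, not_false_eq_true,
      Function.update_self, Function.update_of_ne, i3]
    have : (S + 1) * 1 ≤ (S + 1) * (S + 1) := Nat.mul_le_mul_left _ (by omega)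
    refine ⟨by omega, by omega, by omega, by omega,
      ⟨stackPts P (σ.arr aSt) (τ.reg rI) ++ O, ?_, ?_, ?_, i2⟩, trivial, r1, by omega⟩
    · simpa [r0] using h.size
    · simpa [r1] using h.blocks
    · simpa [r1] using hst.flush hk

/-- What a pass contributes to the output. -/
def PassOutput (P : Fin n → ℝ × ℝ) (d : Bool) (σ τ : State 10 2) : Prop :=
  ∃ L, IsHullChain d (Set.range P) L ∧ τ.out = σ.out ++ L.dropLast

/-- The base left on the stack is the last point of the chain and has not been reported, hence
`dropLast`. -/
theorem PassInv.output {out₀ O : List (ℝ × ℝ)} {τ : State 10 2} (h : PassInv P d S out₀ O τ)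
    (htop : τ.reg rTop = 1) (hE : n ≤ τ.reg rE) :
    ∃ L, IsHullChain d (Set.range P) L ∧ τ.out = out₀ ++ L.dropLast := by
  have hst := h.stack
  rw [htop] at hst
  refine ⟨(readPoint P (τ.arr aSt 0) :: O).reverse, ⟨?_, ?_, ?_, ?_⟩, ?_⟩
  · intro p hp
    rcases List.mem_cons.1 (List.mem_reverse.1 hp) with rfl | hp
    · exact readPoint_mem_range (hst.lt 0 (by omega))
    · exact hst.mem p hp
  · exact List.pairwise_reverse.2 hst.chain.pairwise
  · exact List.triplewise_reverse.2 hst.chain.triplewise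
  · rintro _ ⟨i, rfl⟩
    have := hst.cover i i.2 fun hp => absurd hp.1 (by omega)
    have e : readPoint P (i : ℕ) = P i := by simp [readPoint]
    rw [e] at this
    exact this.imp List.mem_reverse.2 id
  · rw [List.reverse_cons, List.dropLast_concat, h.out]

theorem wp_pass (hs : Sizes n S w) (hmin : ∀ k < S, k * k < n) (σ : State 10 2) :
    WP P (S + 1) w (pass d) σ fun t τ => PassOutput P d σ τ ∧ t ≤ 20000 * (S * S * S) := by
  obtain ⟨h0, h1, h2, h3, h4⟩ := id hs
  have hS0 : 0 < S := by nlinarith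
  simp only [pass, wp_seq]
  refine (wp_start hs hmin σ).mono ?_
  rintro t₁ σ₁ ⟨a1, a2, a3, a4, a5⟩
  refine (wp_next (P := P) (d := d) hs a2 (by rwa [a3])).mono ?_
  rintro t₂ σ₂ ⟨b1, b2, b3, b4, b5, b6, b7, b8⟩
  rw [a3] at b2
  have hE : σ₂.reg rE < n := by
    rcases b2 with b2 | b2
    · exact absurd (Or.inl rfl) (b2.2 0 h0)
    · exact b2.1
  simp only [wp_store, wp_assign, WExp.eval, WExp.cost]
  refine ⟨by omega, by omega, by omega, ?_⟩
  refine (wp_next (P := P) (d := d) hs ?_ ?_).mono ?_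
  · simpa using b6
  · simpa using b3 hE
  rintro t₃ σ₃ ⟨c1, c2, c3, c4, c5, c6, c7, c8⟩
  simp only [ne_eq, Fin.reduceEq, not_false_eq_true, Function.update_self,
    Function.update_of_ne] at c2 c4 c5 c7
  have hinit : PassInv P d S σ.out [] σ₃ := by
    refine ⟨c6, c3, ?_, by rw [c5, b5, a5]; simp⟩
    rw [c4, c7]
    have hfirst : ∀ i < n, i = σ₂.reg rE ∨ Before P d (σ₂.reg rE) i := fun i hi =>
      (after_iff_of_isFirst b2 hE hi).1 (Or.inl rfl)
    refine ⟨by omega, fun j hj => ?_, by simp, trivial, fun i hi hp => ?_, fun i hi hp => ?_,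
      by simp⟩
    · obtain rfl : j = 0 := by omega
      simpa using hE
    · rcases hfirst i hi with rfl | hb
      · exact Or.inl (by simp [stackPts])
      · refine absurd ?_ hp
        have := (pending_next hE c2 hi).1 ⟨hE, fun hb' =>
          before_irrefl d i (before_trans hb' hb)⟩
        exact this.resolve_left fun e => before_irrefl d i (by rwa [← e] at hb)
    · simp only [Nat.sub_self, Function.update_self]
      rcases hfirst i hi with rfl | hb
      · exact dirLt_irrefl d _
      · exact not_dirLt_of_before hb
  have hpend := pendingCount_le (P := P) (d := d) (σ₃.reg rE)
  -- A batch costs about 800 (S + 1)² ≤ 1600 S (S + 1) steps and, unless it is the last, consumes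
  -- `S` pending positions; the extra summand `S` pays for the final, possibly partial batch.
  refine (WP.loop (fun τ => (∃ O, PassInv P d S σ.out O τ) ∧ τ.reg rTop = 1)
    (fun τ => if τ.reg rE < n then (pendingCount P d (τ.reg rE) + S) * (1800 * (S + 1)) else 0)
    ?_ ⟨⟨[], hinit⟩, c7⟩).mono ?_
  · rintro τ ⟨⟨O, i1⟩, i2⟩ hc
    simp only [Test.Holds, WExp.eval] at hc
    simp only [wp_seq]
    refine (wp_pushBatch hs i1 i2).mono ?_
    rintro t₁ τ₁ ⟨j1, j2, j3, j4⟩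
    refine (wp_filterBatch hs j1 j2).mono ?_
    rintro t₂ τ₂ ⟨k1, k2, k3, k4, k5⟩
    refine (wp_flushBatch hs k1 k2 k3).mono ?_
    rintro t₃ τ₃ ⟨l1, l2, l3, l4⟩
    refine ⟨⟨l1, l2⟩, ?_⟩
    simp only [Test.cost, WExp.cost]
    rw [l3, k4, if_pos hc]
    have e₁ : (S + 1) * (S + 1) ≤ (2 * S) * (S + 1) := Nat.mul_le_mul_right _ (by omega)
    have e₂ : (2 * S) * (S + 1) = 2 * (S * (S + 1)) := by ring
    have e₃ : (S + 1) * 1 ≤ (S + 1) * (S + 1) := Nat.mul_le_mul_left _ (by omega)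
    have e₄ : S * (1800 * (S + 1)) = 1800 * (S * (S + 1)) := by ring
    split_ifs with hlt
    · have hcnt := j3.resolve_left (by omega)
      rw [← hcnt, add_mul (pendingCount P d (τ₁.reg rE) + S) S]
      omega
    · rw [add_mul]
      omega
  · rintro t τ ⟨⟨⟨O, i1⟩, i2⟩, hc, hμ⟩
    simp only [Test.Holds, WExp.eval] at hc
    refine ⟨i1.output i2 (by omega), ?_⟩
    simp only [Test.cost, WExp.cost] at hμ
    have e₀ : (if σ₃.reg rE < n then
        (pendingCount P d (σ₃.reg rE) + S) * (1800 * (S + 1)) else 0) ≤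
        (S * S + S * S) * (1800 * (S + S)) := by
      split_ifs
      · refine Nat.mul_le_mul ?_ (by omega)
        have : S * 1 ≤ S * S := Nat.mul_le_mul_left _ hS0
        omega
      · omega
    have e₁ : (S * S + S * S) * (1800 * (S + S)) = 7200 * (S * S * S) := by ring
    have e₂ : (S + 1) * (S + 1) ≤ (S + S) * (S + S) :=
      Nat.mul_le_mul (by omega) (by omega)
    have e₃ : (S + S) * (S + S) = 4 * (S * S) := by ring
    have e₄ : S * S * 1 ≤ S * S * S := Nat.mul_le_mul_left _ hS0
    have e₅ : S * 1 ≤ S * S := Nat.mul_le_mul_left _ hS0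
    omega

theorem wp_reportIfConstant (hs : Sizes n S w) (σ : State 10 2) :
    WP P (S + 1) w reportIfConstant σ fun t τ => t ≤ 200 * (S * S * S) ∧
      (((Set.range P).Nontrivial ∧ τ.out = σ.out) ∨
        ∃ p, Set.range P = {p} ∧ τ.out = σ.out ++ [p]) := by
  obtain ⟨h0, h1, h2, h3, h4⟩ := id hs
  have hS0 : 0 < S := by nlinarith
  have hread : ∀ i : Fin n, readPoint P (i : ℕ) = P i := fun i => by simp [readPoint]
  simp only [reportIfConstant, wp_seq, wp_assign, WExp.eval, WExp.cost]
  refine ⟨by omega, ?_⟩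
  refine (WP.loop (fun τ => τ.reg rI ≤ n ∧ τ.out = σ.out ∧
      ∀ i < τ.reg rI, readPoint P i = readPoint P 0)
    (fun τ => 70 * (n - τ.reg rI)) ?_ ?_).mono ?_
  · rintro τ ⟨i1, i2, i3⟩ hc
    simp only [Test.Holds, WExp.eval, holds_lexTest, not_or] at hc
    simp only [wp_assign, WExp.eval, WExp.cost, Test.cost, lexTest, RExp.cost,
      Function.update_self, i2, true_and]
    refine ⟨by omega, ⟨by omega, fun i hi => ?_⟩, by omega⟩
    rcases Nat.lt_succ_iff_lt_or_eq.1 hi with hi | rfl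
    · exact i3 i hi
    · rcases lexLt_total (readPoint P (τ.reg rI)) (readPoint P 0) with h | h | h
      exacts [absurd h hc.2.2, h, absurd h hc.2.1]
  · simp
  · rintro t τ ⟨⟨i1, i2, i3⟩, hc, hμ⟩
    simp only [Test.Holds, WExp.eval, holds_lexTest] at hc
    simp only [WExp.cost, Test.cost, lexTest, RExp.cost, Function.update_self] at hμ
    have e₁ : S * S * 1 ≤ S * S * S := Nat.mul_le_mul_left _ hS0
    simp only [wp_ite, wp_skip, wp_report, Test.Holds, Test.cost, WExp.eval, WExp.cost, i2]
    refine ⟨fun hlt => ⟨by omega, Or.inl ⟨?_, trivial⟩⟩,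
      fun hge => ⟨by omega, Or.inr ⟨readPoint P 0, ?_, rfl⟩⟩⟩
    · refine ⟨_, readPoint_mem_range h0, _, readPoint_mem_range hlt, fun e => hc ⟨hlt, ?_⟩⟩
      rw [e]
      simp [lexLt_irrefl]
    · refine Set.Subset.antisymm ?_ ?_
      · rintro _ ⟨i, rfl⟩
        rw [Set.mem_singleton_iff, ← hread i]
        exact i3 i (by omega)
      · rw [Set.singleton_subset_iff]
        exact readPoint_mem_range h0

theorem wp_hullProg (hs : Sizes n S w) (hmin : ∀ k < S, k * k < n) :
    WP P (S + 1) w hullProg (State.init 10 2) fun t τ =>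
      IsConvexHullList (Set.range P) τ.out ∧ t ≤ 50000 * (S * S * S) := by
  simp only [hullProg, wp_seq]
  refine (wp_reportIfConstant hs _).mono ?_
  rintro t₁ σ₁ ⟨h₁, h₁'⟩
  refine (wp_pass hs hmin σ₁).mono ?_
  rintro t₂ σ₂ ⟨⟨O, hO, ho₂⟩, h₂⟩
  refine (wp_pass hs hmin σ₂).mono ?_
  rintro t₃ σ₃ ⟨⟨D, hD, ho₃⟩, h₃⟩
  refine ⟨?_, by omega⟩
  rw [ho₃, ho₂]
  rcases h₁' with ⟨hnt, ho⟩ | ⟨p, hp, ho⟩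
  · rw [ho]
    exact isConvexHullList_of_chains (Set.finite_range P) hnt hO hD
  · rw [hp] at hO hD ⊢
    rw [ho, hO.dropLast_eq_nil, hD.dropLast_eq_nil]
    exact isConvexHullList_singleton p

end PointRAM

/-! ### The bounds in terms of `n` -/

theorem theorem1 :
    ∃ (k m : ℕ) (prog : PointRAM.Prog k m) (c : ℕ) (C : ℝ),
      ∀ (n : ℕ), 0 < n → ∀ P : Fin n → ℝ × ℝ,
        ∃ (s t : ℕ) (τ : PointRAM.State k m),
          PointRAM.Exec P s ((n + 1) ^ c) prog (PointRAM.State.init k m) t τ ∧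
          IsConvexHullList (Set.range P) τ.out ∧
          ((k + m * s : ℕ) : ℝ) ≤ C * (n : ℝ) ^ (1 / 2 : ℝ) ∧
          ∀ ε : ℝ, √(Real.log (Real.log n) / Real.log n) < ε → ε < 1 →
            (t : ℝ) ≤ C * (n : ℝ) ^ (3 / 2 + ε) := by
  -- The time bound is 50000 S³ with S ≤ 2√n, and 400000 = 50000 · 8; this also exceeds the space
  -- constant. Words below (n + 1)² can hold `S * S`.
  refine ⟨10, 2, PointRAM.hullProg, 2, 400000, fun n hn P => ?_⟩
  have hex : ∃ S, n ≤ S * S := ⟨n, Nat.le_mul_self n⟩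
  classical
  set S := Nat.find hex with hS
  have hle : n ≤ S * S := Nat.find_spec hex
  have hmin : ∀ k < S, k * k < n := fun k hk => not_le.1 (Nat.find_min hex hk)
  have hSn : S ≤ n := Nat.find_min' hex (Nat.le_mul_self n)
  have hsq : S * S ≤ n * n := Nat.mul_le_mul hSn hSn
  have hs : PointRAM.Sizes n S ((n + 1) ^ 2) :=
    ⟨hn, hle, hSn, by nlinarith, by nlinarith⟩
  obtain ⟨t, τ, hexec, hhull, ht⟩ := PointRAM.wp_hullProg (P := P) hs hmin
  refine ⟨S + 1, t, τ, hexec, hhull, ?_, fun ε hε _ => ?_⟩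
  all_goals
    have hn1 : (1 : ℝ) ≤ n := by exact_mod_cast hn
    have hroot : (S : ℝ) ≤ 2 * √n := by
      have h1 : (1 : ℝ) ≤ √n := Real.one_le_sqrt.2 hn1
      rcases Nat.eq_zero_or_pos S with h0 | h0
      · rw [h0, Nat.cast_zero]
        positivity
      · have h2 : ((S - 1 : ℕ) : ℝ) ≤ √n := by
          refine Real.le_sqrt_of_sq_le ?_
          rw [sq]
          exact_mod_cast (hmin (S - 1) (by omega)).le
        rw [Nat.cast_sub h0, Nat.cast_one] at h2
        linarith
  · rw [← Real.sqrt_eq_rpow]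
    have h1 : (1 : ℝ) ≤ √n := Real.one_le_sqrt.2 hn1
    push_cast
    linarith
  -- Only the nonnegativity of ε is needed, since the running time is already O(n^(3/2)).
  · have hε0 : 0 ≤ ε := (Real.sqrt_nonneg _).trans hε.le
    have hcube : (S * S * S : ℝ) ≤ 8 * (n : ℝ) ^ (3 / 2 : ℝ) := by
      have e : (n : ℝ) ^ (3 / 2 : ℝ) = √n ^ 3 := by
        rw [Real.sqrt_eq_rpow, ← Real.rpow_natCast, ← Real.rpow_mul (by positivity)]
        norm_num
      have := pow_le_pow_left₀ (by positivity) hroot 3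
      rw [e]
      linarith
    have hmono : (n : ℝ) ^ (3 / 2 : ℝ) ≤ (n : ℝ) ^ (3 / 2 + ε) :=
      Real.rpow_le_rpow_of_exponent_le hn1 (by linarith)
    have ht' : (t : ℝ) ≤ 50000 * (S * S * S) := by exact_mod_cast ht
    linarith
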